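/- **Setting.** Let $n\ge 3$, let $m_1,\dots,m_n>0$, let $M=\mathrm{diag}(m_1I_4,\dots,m_nI_4)$ and let $U(q)=\sum_{i<j}\frac{m_im_j}{|q_i-q_j|}$ be the Newtonian potential on collision-free configurations $q=(q_1,\dots,q_n)\in(\mathbb R^4)^n$. A *central configuration* is a collision-free $q$ with $\sum_i m_iq_i=0$ and $$\nabla U(q)+\lambda Mq=0,\qquad \lambda=\frac{U(q)}{\langle Mq,q\rangle}.$$ Put $k=\sqrt\lambda$ and let $R_d(t)$ act on each copy of $\mathbb R^4$ by $\mathrm{diag}(\Theta(t),\Theta(-t))$, where $\Theta(t)$ is the rotation of $\mathbb R^2$ by the angle $kt$. The *relative equilibrium* (RE) generated by $q$ is $\gamma(t)=R_d(t)q$. It is *planar* if all bodies stay for all times in one fixed $2$-dimensional linear subspace $P\subset\mathbb R^4$. The configuration $q$ is *collinear* if $q_1,\dots,q_n$ lie on one line. **Linearization.** Let $\mathbf i,\mathbf j,\mathbf k$ be the real $4\times4$ matrices of left multiplication by the quaternion units, with $\mathbf i=\mathrm{diag}(i,-i)$, $i=\begin{pmatrix}0&-1\\1&0\end{pmatrix}$.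 Let $k_d=k\,\mathbf i$ be the generator of $R_d$. If $\gamma$ is planar with plane $P$, let $k_s$ be the operator equal to $k_d$ on $P$ and to $0$ on $P^\perp$; thus $k_s=k\,\mathrm{diag}(i,0)$ if $P=\mathbb R^2\times\{0\}$. For $*\in\{d,s\}$ let $K_*=\mathrm{diag}(k_*,\dots,k_*)$ and $$L_*=\begin{pmatrix}K_*&M^{-1}\\ D^2U(q)&K_*\end{pmatrix},\qquad B_*=JL_*=\begin{pmatrix}-D^2U(q)&-K_*\\K_*&M^{-1}\end{pmatrix},\qquad J=\begin{pmatrix}0&-I\\I&0\end{pmatrix}$$ on $\mathbb R^{8n}$, with symplectic form $\omega_0=\langle J\cdot,\cdot\rangle$. Let $$E_1=\{(v,\dots,v,m_1w,\dots,m_nw): v,w\in\mathbb R^4\},$$ $$E_2^d=\mathrm{span}\{(aq,0),(0,aMq): a\in\{1,\mathbf i,\mathbf j,\mathbf k\}\},$$ $$E_2^s=\mathrm{span}\{(q,0),(0,Mq),(K_{lr}q,0),(0,MK_{lr}q): 1\le l<r\le4\},$$ where $K_{lr}$ acts on each copy of $\mathbb R^4$ by the infinitesimal rotation of the $(l,r)$-coordinate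 plane. Let $E_3^*$ be the $\omega_0$-orthogonal complement of $E_1\oplus E_2^*$. For $*=d$, and for $*=s$ when $\gamma$ is planar, it is an $L_*$-invariant symplectic subspace; let $B_3^*$ be the symmetric form obtained by restricting $B_*$ to $E_3^*$, and $JB_3^*$ the restriction of $JB_*=-L_*$ to $E_3^*$. Write $n^-$ for the number of negative eigenvalues (negative inertia index). The RE $\gamma$ is *spectrally stable* if all complex eigenvalues of $L_*|_{E_3^*}$ are purely imaginary, where $*=s$ if $\gamma$ is planar and $*=d$ otherwise, and *spectrally unstable* if it is not spectrally stable. **Theorem.** Let $\gamma$ be the RE in $\mathbb R^4$ generated by a central configuration $q$. 1. If $\gamma$ is non-planar, or $\gamma$ is planar and $q$ is collinear, and if $$n^-\bigl(B_3^d|_{\ker(JB_3^d)^{8n-16}}\bigr)-n^-(B_3^d)\equiv1\pmod 2,$$ then $\gamma$ is spectrally unstable. If $\gamma$ is planar and $q$ is collinear, the same conclusion holds if the congruence holds with $B_3^s$ in place of $B_3^d$. 2. If $\gamma$ is planar and $q$ is not collinear, and if $$n^-\bigl(B_3^s|_{\ker(JB_3^s)^{8n-20}}\bigr)-n^-(B_3^s)\equiv1\pmod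 2,$$ then $\gamma$ is spectrally unstable. -/

import Mathlib

open scoped TensorProduct

noncomputable section

namespace RelEq

/-! ### Configurations, potential, central configurations -/

/-- Euclidean four-space. -/
abbrev E4 := EuclideanSpace ℝ (Fin 4)

/-- Configurations of `n` particles in `ℝ⁴`, with the Euclidean structure of `ℝ⁴ⁿ`. -/
abbrev Config (n : ℕ) := PiLp 2 (fun _ : Fin n => E4)

variable {n : ℕ}

/-- The Newtonian potential `U(q) = ∑_{i<j} mᵢ mⱼ / |qᵢ - qⱼ|`. -/
def potential (m : Fin n → ℝ) (q : Config n) : ℝ :=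
  ∑ i, ∑ j ∈ Finset.Ioi i, m i * m j / ‖q i - q j‖

/-- The block diagonal operator `diag(a₁, …, aₙ)` of `ℝ⁴ⁿ` with `4 × 4` blocks `aᵢ`. -/
def blockDiag (a : Fin n → (E4 →ₗ[ℝ] E4)) : Config n →ₗ[ℝ] Config n where
  toFun x := WithLp.toLp 2 (fun i => a i (x i))
  map_add' x y := by ext i; simp
  map_smul' c x := by ext i; simp

/-- The mass matrix `M = diag(m₁ I₄, …, mₙ I₄)`. -/
def massOp (m : Fin n → ℝ) : Config n →ₗ[ℝ] Config n :=
  blockDiag (fun i => m i • LinearMap.id)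

/-- The inverse `M⁻¹` of the mass matrix (for non-zero masses). -/
def massInv (m : Fin n → ℝ) : Config n →ₗ[ℝ] Config n :=
  blockDiag (fun i => (m i)⁻¹ • LinearMap.id)

/-- The diagonal action on `ℝ⁴ⁿ` of a linear operator of `ℝ⁴`. -/
def diagAct (a : E4 →ₗ[ℝ] E4) : Config n →ₗ[ℝ] Config n :=
  blockDiag (fun _ => a)

/-- The moment of inertia `⟨Mq, q⟩`. -/
def inertia (m : Fin n → ℝ) (q : Config n) : ℝ := inner ℝ (massOp m q) q

/-- `q` is a central configuration: it has no collisions, its centre of mass is at the origin,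
and `∇U(q) + λ M q = 0` with `λ = U(q) / ⟨Mq, q⟩`. -/
structure IsCentralConfiguration (m : Fin n → ℝ) (q : Config n) : Prop where
  collisionFree : ∀ i j, i ≠ j → q i ≠ q j
  center : ∑ i, m i • q i = 0
  balance : gradient (potential m) q + (potential m q / inertia m q) • massOp m q = 0

/-- All bodies lie on one line. -/
def IsCollinear (q : Config n) : Prop := Collinear ℝ (Set.range (fun i => q i))

/-! ### The relative equilibrium -/

/-- The angular speed `k = √λ`, `λ = U(q) / ⟨Mq, q⟩`. -/
def angSpeed (m : Fin n → ℝ) (q : Config n) : ℝ := √(potential m q / inertia m q)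

/-- The double rotation `diag(Θ, Θ⁻¹)`, `Θ` being the rotation of the plane by the angle `φ`. -/
def doubleRotation (φ : ℝ) : Matrix (Fin 4) (Fin 4) ℝ :=
  !![Real.cos φ, -Real.sin φ, 0, 0;
     Real.sin φ, Real.cos φ, 0, 0;
     0, 0, Real.cos φ, Real.sin φ;
     0, 0, -Real.sin φ, Real.cos φ]

/-- The (circular) relative equilibrium `γ(t) = R_d(t) q` generated by `q`. -/
def relEquilibrium (m : Fin n → ℝ) (q : Config n) (t : ℝ) : Config n :=
  diagAct (Matrix.toEuclideanLin (doubleRotation (angSpeed m q * t))) q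

/-- The relative equilibrium generated by `q` is planar: the motion takes place in a fixed
two-dimensional plane. -/
def IsPlanarRE (m : Fin n → ℝ) (q : Config n) : Prop :=
  ∃ P : Submodule ℝ E4, Module.finrank ℝ P = 2 ∧ ∀ t i, relEquilibrium m q t i ∈ P

/-- The linear span in `ℝ⁴` of all the positions taken by the bodies along the relative
equilibrium; for a planar relative equilibrium, the plane of the motion. -/
def motionSpan (m : Fin n → ℝ) (q : Config n) : Submodule ℝ E4 :=
  Submodule.span ℝ {x | ∃ t i, x = relEquilibrium m q t i}

/-! ### The rotating frames -/

/-- The quaternion unit `i` as a real `4 × 4` matrix. -/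
def quatI : Matrix (Fin 4) (Fin 4) ℝ :=
  !![0, -1, 0, 0; 1, 0, 0, 0; 0, 0, 0, 1; 0, 0, -1, 0]

/-- The quaternion unit `j` as a real `4 × 4` matrix. -/
def quatJ : Matrix (Fin 4) (Fin 4) ℝ :=
  !![0, 0, 1, 0; 0, 0, 0, 1; -1, 0, 0, 0; 0, -1, 0, 0]

/-- The quaternion unit `k` as a real `4 × 4` matrix. -/
def quatK : Matrix (Fin 4) (Fin 4) ℝ :=
  !![0, 0, 0, -1; 0, 0, 1, 0; 0, -1, 0, 0; 1, 0, 0, 0]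

/-- The generator `k_d = k diag(i, -i)` of the double rotation `R_d`. -/
def genDouble (m : Fin n → ℝ) (q : Config n) : E4 →ₗ[ℝ] E4 :=
  angSpeed m q • Matrix.toEuclideanLin quatI

/-- The generator `k_s` of the simple rotation which has the same effect as `R_d` on the plane of
a planar relative equilibrium and which fixes the orthogonal complement of that plane pointwise.
When the plane is `ℝ² × {0}` this is `k_s = k diag(i, 0)`. -/
def genSimple (m : Fin n → ℝ) (q : Config n) : E4 →ₗ[ℝ] E4 :=
  genDouble m q ∘ₗ (motionSpan m q).starProjection.toLinearMap

/-! ### The linearized Hamiltonian system -/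

/-- The phase space `T*ℝ⁴ⁿ = ℝ⁸ⁿ`, with elements `(x, p)`. -/
abbrev Phase (n : ℕ) := Config n × Config n

/-- The Euclidean scalar product of `ℝ⁸ⁿ`. -/
def dot : LinearMap.BilinForm ℝ (Phase n) :=
  LinearMap.mk₂ ℝ (fun z w => inner ℝ z.1 w.1 + inner ℝ z.2 w.2)
    (fun z z' w => by simp only [Prod.fst_add, Prod.snd_add, inner_add_left]; ring)
    (fun c z w => by
      simp only [Prod.smul_fst, Prod.smul_snd, real_inner_smul_left, smul_eq_mul]; ring)
    (fun z w w' => by simp only [Prod.fst_add, Prod.snd_add, inner_add_right]; ring)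
    (fun c z w => by
      simp only [Prod.smul_fst, Prod.smul_snd, real_inner_smul_right, smul_eq_mul]; ring)

/-- The standard complex structure `J (x, p) = (-p, x)`. -/
def stdJ : Phase n →ₗ[ℝ] Phase n :=
  LinearMap.prod (-LinearMap.snd ℝ (Config n) (Config n)) (LinearMap.fst ℝ (Config n) (Config n))

/-- The standard symplectic form `ω₀(z, w) = ⟨J z, w⟩`. -/
def omega : LinearMap.BilinForm ℝ (Phase n) := dot ∘ₗ stdJ

/-- The second derivative `D²U(q)` of the potential, as a linear operator of `ℝ⁴ⁿ`. -/
def hessU (m : Fin n → ℝ) (q : Config n) : Config n →ₗ[ℝ] Config n :=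
  (fderiv ℝ (gradient (potential m)) q).toLinearMap

/-- The Hamiltonian matrix `L = (K, M⁻¹; D²U(q), K)` of the linearization at `q` of the equations
of motion in the rotating frame with generator `a`, where `K = diag(a, …, a)`. -/
def hamL (m : Fin n → ℝ) (q : Config n) (a : E4 →ₗ[ℝ] E4) : Phase n →ₗ[ℝ] Phase n :=
  LinearMap.prod
    (diagAct a ∘ₗ LinearMap.fst ℝ (Config n) (Config n) +
      massInv m ∘ₗ LinearMap.snd ℝ (Config n) (Config n))
    (hessU m q ∘ₗ LinearMap.fst ℝ (Config n) (Config n) +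
      diagAct a ∘ₗ LinearMap.snd ℝ (Config n) (Config n))

/-- The symmetric matrix `B = J L = (-D²U(q), -K; K, M⁻¹)`, so that `L = -J B`. -/
def matB (m : Fin n → ℝ) (q : Config n) (a : E4 →ₗ[ℝ] E4) : Phase n →ₗ[ℝ] Phase n :=
  stdJ ∘ₗ hamL m q a

/-- The quadratic form `z ↦ ⟨B z, z⟩`. -/
def formB (m : Fin n → ℝ) (q : Config n) (a : E4 →ₗ[ℝ] E4) : QuadraticForm ℝ (Phase n) :=
  LinearMap.BilinMap.toQuadraticMap (dot ∘ₗ matB m q a)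

/-! ### The invariant symplectic subspaces -/

/-- `E₁ = {(v, …, v, m₁ w, …, mₙ w)}`, `v, w ∈ ℝ⁴`. -/
def E1 (m : Fin n → ℝ) : Submodule ℝ (Phase n) :=
  Submodule.span ℝ {z | ∃ v w : E4,
    z = (WithLp.toLp 2 (fun _ => v), WithLp.toLp 2 (fun i => m i • w))}

/-- `E₂ᵈ`, the span of `(a q, 0)` and `(0, a M q)` for `a` among the quaternions `1, i, j, k`. -/
def E2d (m : Fin n → ℝ) (q : Config n) : Submodule ℝ (Phase n) :=
  Submodule.span ℝ {z | ∃ a ∈ ({1, quatI, quatJ, quatK} : Set (Matrix (Fin 4) (Fin 4) ℝ)),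
    z = (diagAct (Matrix.toEuclideanLin a) q, 0) ∨
    z = (0, diagAct (Matrix.toEuclideanLin a) (massOp m q))}

/-- The generator `k_{lr}` of the rotations of the `(l, r)`-coordinate plane: entry `-1` at
`(l, r)`, entry `1` at `(r, l)`, and `0` elsewhere. -/
def genRot (l r : Fin 4) : Matrix (Fin 4) (Fin 4) ℝ :=
  Matrix.single r l 1 - Matrix.single l r 1

/-- `E₂ˢ`, the span of `(q, 0)`, `(0, M q)` and of all `(K_{lr} q, 0)`, `(0, M K_{lr} q)`. If `q`
lies in the plane `ℝ² × {0}`, then `K_{34} q = 0`, so that this pair may be left out. -/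
def E2s (m : Fin n → ℝ) (q : Config n) : Submodule ℝ (Phase n) :=
  Submodule.span ℝ ({(q, 0), (0, massOp m q)} ∪ {z | ∃ l r : Fin 4, l < r ∧
    (z = (diagAct (Matrix.toEuclideanLin (genRot l r)) q, 0) ∨
     z = (0, massOp m (diagAct (Matrix.toEuclideanLin (genRot l r)) q)))})

/-- `E₃ᵈ`, the symplectic orthogonal complement of `E₁ ⊕ E₂ᵈ`. -/
def E3d (m : Fin n → ℝ) (q : Config n) : Submodule ℝ (Phase n) :=
  omega.orthogonal (E1 m ⊔ E2d m q)

/-- `E₃ˢ`, the symplectic orthogonal complement of `E₁ ⊕ E₂ˢ`. -/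
def E3s (m : Fin n → ℝ) (q : Config n) : Submodule ℝ (Phase n) :=
  omega.orthogonal (E1 m ⊔ E2s m q)

/-! ### Inertia indices and spectral stability -/

/-- `n⁻(B₃)`, the negative inertia index of the restriction `B₃` of `B` to `E₃`. -/
def indexB3 (m : Fin n → ℝ) (q : Config n) (a : E4 →ₗ[ℝ] E4)
    (E₃ : Submodule ℝ (Phase n)) : ℕ :=
  _root_.sigNeg ((formB m q a).restrict E₃)

/-- `n⁻(B₃|_{ker (J B₃)^N})`. Since `E₃` is invariant, `J B₃` is the restriction of `J B` to `E₃`,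
so that `ker (J B₃)^N = E₃ ∩ ker (J B)^N`. -/
def indexB3Ker (m : Fin n → ℝ) (q : Config n) (a : E4 →ₗ[ℝ] E4)
    (E₃ : Submodule ℝ (Phase n)) (N : ℕ) : ℕ :=
  _root_.sigNeg
    ((formB m q a).restrict (E₃ ⊓ LinearMap.ker ((stdJ ∘ₗ matB m q a) ^ N)))

/-- The eigenvalues (in `ℂ`) of the restriction of `L` to the invariant subspace `E₃` are all
purely imaginary. An eigenvalue of the restriction is an eigenvalue of the complexification of `L`
with an eigenvector in the complexification of `E₃`. -/
def IsStableOn (L : Phase n →ₗ[ℝ] Phase n) (E₃ : Submodule ℝ (Phase n)) : Prop :=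
  ∀ μ : ℂ, (∃ v ∈ E₃.baseChange ℂ, v ≠ 0 ∧ L.baseChange ℂ v = μ • v) → μ.re = 0

open Classical in
/-- Spectral stability of the relative equilibrium generated by `q`: the Hamiltonian matrix on
`E₃` has purely imaginary spectrum. The simple rotating frame is used for a planar relative
equilibrium, the double one otherwise. -/
def IsSpectrallyStable (m : Fin n → ℝ) (q : Config n) : Prop :=
  if IsPlanarRE m q then IsStableOn (hamL m q (genSimple m q)) (E3s m q)
  else IsStableOn (hamL m q (genDouble m q)) (E3d m q)

end RelEq

end

/-!
Let `A` be an invertible linear Hamiltonian vector field on a symplectic space and let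
`Q z = ω (A z) z`. The Gram determinant of `Q` is `det A` times that of `ω`, and the latter is
positive, being the determinant of an invertible skew-symmetric matrix. Hence `n⁻(Q)` is even as
soon as `det A > 0`, which is the case when `A` has no negative eigenvalue. On a general symplectic
space, split off the generalized kernel of `A`: its symplectic complement is the Fitting range,
where `A` is invertible. If `A` is spectrally stable, then `n⁻(Q)` is even there, so `n⁻(Q)` and the
index of `Q` on the generalized kernel have the same parity.

The exponents `8n - 16` and `8n - 20` bound `dim E₃`, since the configurations `v + a q` with `a` a
quaternion, respectively an infinitesimal similarity, span a space of dimension at least `8`,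
respectively `10` if `q` is planar and not collinear.

For a planar motion of a collinear configuration the stability hypothesis concerns the simple
frame, while the index may be that of the double one. The two subspaces `E₃` then agree, and the two
Hamiltonian matrices differ by a rotation generator of the plane orthogonal to the motion. It
commutes with the Hessian because isometries fixing `q` do, and its spectrum is imaginary, so that
stability carries over from one frame to the other.
-/

section Inertia

open QuadraticMap

theorem sigNeg_restrict_restrict {R M : Type*} [CommRing R] [LinearOrder R] [AddCommGroup M]
    [Module R M] (Q : QuadraticForm R M) (E : Submodule R M) (K : Submodule R E) :
    sigNeg ((Q.restrict E).restrict K) = sigNeg (Q.restrict (K.map E.subtype)) :=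
  Equivalent.sigNeg_eq ⟨{ toLinearEquiv := E.equivSubtypeMap K, map_app' := fun _ => rfl }⟩

variable {𝕜 V : Type*} [Field 𝕜] [LinearOrder 𝕜] [IsStrictOrderedRing 𝕜]
  [AddCommGroup V] [Module 𝕜 V]

theorem sigNeg_eq_ncard_of_isOrthoᵢ {ι : Type*} [Finite ι] (Q : QuadraticForm 𝕜 V)
    (v : Module.Basis ι 𝕜 V) (hv : (associated (R := 𝕜) Q).IsOrthoᵢ v) :
    sigNeg Q = {i | Q (v i) < 0}.ncard := by
  have := Fintype.ofFinite ι
  apply QuadraticForm.sigNeg_of_equiv_weightedSumSquares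
  rw [← basisRepr_eq_of_iIsOrtho Q v hv]
  exact ⟨Q.isometryEquivBasisRepr v⟩

theorem exists_basis_isOrthoᵢ_associated [FiniteDimensional 𝕜 V] (Q : QuadraticForm 𝕜 V) :
    ∃ v : Module.Basis (Fin (Module.finrank 𝕜 V)) 𝕜 V, (associated (R := 𝕜) Q).IsOrthoᵢ v :=
  LinearMap.BilinForm.exists_orthogonal_basis
    ⟨fun x y => by simpa using associated_isSymm 𝕜 Q x y⟩

theorem isOrthoᵢ_associated_prod_map_prodEquivOfIsCompl {ι κ : Type*} {Q : QuadraticForm 𝕜 V}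
    {K W : Submodule 𝕜 V} (h : IsCompl K W)
    (horth : ∀ x ∈ K, ∀ y ∈ W, associated (R := 𝕜) Q x y = 0)
    {v : Module.Basis ι 𝕜 K} (hv : (associated (R := 𝕜) (Q.restrict K)).IsOrthoᵢ v)
    {w : Module.Basis κ 𝕜 W} (hw : (associated (R := 𝕜) (Q.restrict W)).IsOrthoᵢ w) :
    (associated (R := 𝕜) Q).IsOrthoᵢ ((v.prod w).map (K.prodEquivOfIsCompl W h)) := by
  rintro (i | i) (j | j) hij
  · simpa [Function.onFun, associated_apply] using
      hv (i := i) (j := j) fun h => hij (congrArg Sum.inl h)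
  · simpa [Function.onFun] using horth _ (v i).2 _ (w j).2
  · have := horth _ (v j).2 _ (w i).2
    rw [associated_isSymm 𝕜 Q] at this
    simpa [Function.onFun] using this
  · simpa [Function.onFun, associated_apply] using
      hw (i := i) (j := j) fun h => hij (congrArg Sum.inr h)

theorem sigNeg_eq_add_of_isCompl [FiniteDimensional 𝕜 V] (Q : QuadraticForm 𝕜 V)
    {K W : Submodule 𝕜 V} (h : IsCompl K W)
    (horth : ∀ x ∈ K, ∀ y ∈ W, associated (R := 𝕜) Q x y = 0) :
    sigNeg Q = sigNeg (Q.restrict K) + sigNeg (Q.restrict W) := by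
  obtain ⟨v, hv⟩ := exists_basis_isOrthoᵢ_associated (Q.restrict K)
  obtain ⟨w, hw⟩ := exists_basis_isOrthoᵢ_associated (Q.restrict W)
  rw [sigNeg_eq_ncard_of_isOrthoᵢ Q _
      (isOrthoᵢ_associated_prod_map_prodEquivOfIsCompl h horth hv hw),
    sigNeg_eq_ncard_of_isOrthoᵢ _ v hv, sigNeg_eq_ncard_of_isOrthoᵢ _ w hw]
  simp only [← Nat.card_coe_set_eq]
  rw [← Nat.card_sum]
  exact Nat.card_congr <| Equiv.subtypeSum.trans <| Equiv.sumCongr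
    (Equiv.subtypeEquivRight fun i => by simp) (Equiv.subtypeEquivRight fun i => by simp)

end Inertia

section Parity

theorem prod_eq_neg_one_pow_card_mul_prod_abs {ι R : Type*} [Fintype ι] [CommRing R]
    [LinearOrder R] [IsOrderedRing R] (w : ι → R) :
    ∏ i, w i = (-1) ^ {i | w i < 0}.ncard * ∏ i, |w i| := by
  classical
  have hsign (i : ι) : w i = (if w i < 0 then -1 else 1) * |w i| := by
    split_ifs with hi
    · rw [abs_of_neg hi, neg_one_mul, neg_neg]
    · rw [abs_of_nonneg (not_lt.1 hi), one_mul]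
  rw [Set.ncard_eq_toFinset_card', Set.toFinset_ofPred, ← Finset.prod_const,
    Finset.prod_filter, ← Finset.prod_mul_distrib]
  exact Finset.prod_congr rfl fun i _ => hsign i

theorem even_ncard_neg_of_prod_pos {ι R : Type*} [Fintype ι] [CommRing R] [LinearOrder R]
    [IsOrderedRing R] {w : ι → R} (h : 0 < ∏ i, w i) : Even {i | w i < 0}.ncard := by
  by_contra hodd
  rw [prod_eq_neg_one_pow_card_mul_prod_abs, (Nat.not_even_iff_odd.1 hodd).neg_one_pow,
    neg_one_mul, Left.neg_pos_iff] at h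
  exact h.not_ge (Finset.prod_nonneg fun i _ => abs_nonneg (w i))

theorem det_pos_of_forall_nonpos_not_hasEigenvalue {V : Type*} [AddCommGroup V] [Module ℝ V]
    [FiniteDimensional ℝ V] {f : Module.End ℝ V}
    (h : ∀ μ ≤ 0, ¬ f.HasEigenvalue μ) : 0 < LinearMap.det f := by
  have hdet : (LinearMap.charpoly (-f)).eval 0 = LinearMap.det f := by
    simp [LinearMap.eval_charpoly]
  rw [← hdet]
  refine Polynomial.zero_lt_eval_of_roots_lt_of_leadingCoeff_nonneg (fun x hx => ?_)
    ((LinearMap.charpoly_monic (-f)).leadingCoeff.symm ▸ zero_le_one)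
  obtain ⟨v, hv⟩ :=
    ((Module.End.hasEigenvalue_iff_isRoot_charpoly (-f) x).2 hx).exists_hasEigenvector
  by_contra! hx0
  refine h (-x) (neg_nonpos.2 hx0) (Module.End.hasEigenvalue_of_hasEigenvector (x := v)
    (Module.End.hasEigenvector_iff.2 ⟨Module.End.mem_eigenspace_iff.2 ?_, hv.2⟩))
  rw [neg_smul, ← hv.apply_eq_smul, LinearMap.neg_apply, neg_neg]

theorem matrix_det_pos_of_transpose_eq_neg {ι : Type*} [Fintype ι] [DecidableEq ι]
    {A : Matrix ι ι ℝ} (hA : A.transpose = -A) (hdet : A.det ≠ 0) : 0 < A.det := by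
  rw [← LinearMap.det_toLin']
  refine det_pos_of_forall_nonpos_not_hasEigenvalue fun μ _ hμ => ?_
  obtain ⟨v, hv⟩ := hμ.exists_hasEigenvector
  have hv' : A.mulVec v = μ • v := by simpa using hv.apply_eq_smul
  have horth : v ⬝ᵥ A.mulVec v = -(v ⬝ᵥ A.mulVec v) := by
    conv_lhs => rw [Matrix.dotProduct_mulVec, ← Matrix.mulVec_transpose, hA,
      Matrix.neg_mulVec, neg_dotProduct, dotProduct_comm]
  rw [self_eq_neg, hv', dotProduct_smul, smul_eq_zero, dotProduct_self_eq_zero,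
    or_iff_left hv.2] at horth
  exact hdet (Matrix.exists_mulVec_eq_zero_iff.1 ⟨v, hv.2, by rw [hv', horth, zero_smul]⟩)

theorem det_toMatrix_pos_of_isAlt {ι V : Type*} [Fintype ι] [DecidableEq ι]
    [AddCommGroup V] [Module ℝ V] {ω : LinearMap.BilinForm ℝ V} (v : Module.Basis ι ℝ V)
    (hω : ω.IsAlt) (hnd : ω.Nondegenerate) :
    0 < (LinearMap.BilinForm.toMatrix v ω).det := by
  refine matrix_det_pos_of_transpose_eq_neg ?_
    ((LinearMap.BilinForm.nondegenerate_iff_det_ne_zero v).1 hnd)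
  ext i j
  simp only [Matrix.transpose_apply, LinearMap.BilinForm.toMatrix_apply, Matrix.neg_apply,
    hω.neg_eq]

end Parity

section SkewAdjoint

variable {R M : Type*} [CommRing R] [AddCommGroup M] [Module R M]
  {ω : LinearMap.BilinForm R M} {A : Module.End R M}

/-- The quadratic Hamiltonian `z ↦ ω (A z) z` of the linear vector field `A`. -/
noncomputable def hamiltonianForm (ω : LinearMap.BilinForm R M) (A : Module.End R M) :
    QuadraticForm R M :=
  LinearMap.BilinMap.toQuadraticMap (ω.compLeft A)

@[simp]
theorem hamiltonianForm_apply (z : M) : hamiltonianForm ω A z = ω (A z) z := rfl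

theorem hamiltonianForm_restrict {E : Submodule R M} (hE : ∀ x ∈ E, A x ∈ E) :
    (hamiltonianForm ω A).restrict E = hamiltonianForm (ω.restrict E) (A.restrict hE) := rfl

theorem associated_hamiltonianForm [Invertible (2 : R)] (hω : ω.IsAlt) (hA : ω.IsSkewAdjoint A) :
    QuadraticMap.associated (R := R) (hamiltonianForm ω A) = ω.compLeft A :=
  QuadraticMap.associated_left_inverse R fun x y => by
    simp only [LinearMap.BilinForm.compLeft_apply, hA x y, Pi.neg_apply, map_neg, hω.neg_eq]

theorem isAdjointPair_pow {A' : Module.End R M} (h : LinearMap.IsAdjointPair ω ω A A') (k : ℕ) :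
    LinearMap.IsAdjointPair ω ω (A ^ k : Module.End R M) (A' ^ k : Module.End R M) := by
  induction k with
  | zero => exact fun _ _ => rfl
  | succ k ih =>
    rw [pow_succ, pow_succ']
    exact ih.mul h

theorem orthogonal_range_eq_ker {A' : Module.End R M} (hnd : ω.Nondegenerate)
    (h : LinearMap.IsAdjointPair ω ω A A') :
    ω.orthogonal (LinearMap.range A) = LinearMap.ker A' := by
  ext x
  simp only [LinearMap.BilinForm.mem_orthogonal_iff, LinearMap.mem_range, forall_exists_index,
    forall_apply_eq_imp_iff, h _ x, LinearMap.mem_ker]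
  exact ⟨fun hx => hnd.2 _ hx, fun hx y => by rw [hx, map_zero]⟩

theorem orthogonal_range_pow_eq_ker_pow (hnd : ω.Nondegenerate) (hA : ω.IsSkewAdjoint A) (k : ℕ) :
    ω.orthogonal (LinearMap.range (A ^ k)) = LinearMap.ker (A ^ k) := by
  rw [orthogonal_range_eq_ker hnd (isAdjointPair_pow (A' := -A) hA k), neg_pow]
  rcases neg_one_pow_eq_or (Module.End R M) k with h | h <;> rw [h] <;> ext x <;> simp

theorem isSkewAdjoint_restrict {E : Submodule R M} (hA : ω.IsSkewAdjoint A)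
    (hE : ∀ x ∈ E, A x ∈ E) : (ω.restrict E).IsSkewAdjoint (A.restrict hE) :=
  fun x y => hA x y

theorem map_subtype_ker_restrict_pow {E : Submodule R M} (hE : ∀ x ∈ E, A x ∈ E) (k : ℕ) :
    (LinearMap.ker (A.restrict hE ^ k)).map E.subtype = E ⊓ LinearMap.ker (A ^ k) := by
  rw [Module.End.pow_restrict, LinearMap.ker_restrict, Submodule.map_comap_subtype]

theorem apply_mem_range_pow (k : ℕ) :
    ∀ x ∈ LinearMap.range (A ^ k), A x ∈ LinearMap.range (A ^ k) := by
  rintro _ ⟨y, rfl⟩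
  exact ⟨A y, by rw [← Module.End.mul_apply, ← Module.End.mul_apply, ← pow_succ, pow_succ']⟩

end SkewAdjoint

section Fitting

variable {K V : Type*} [Field K] [AddCommGroup V] [Module K V] [FiniteDimensional K V]

theorem isCompl_ker_pow_range_pow (A : Module.End K V) {N : ℕ} (hN : Module.finrank K V ≤ N) :
    IsCompl (LinearMap.ker (A ^ N)) (LinearMap.range (A ^ N)) := by
  refine (Submodule.isCompl_iff_disjoint _ _ ?_).2 (Submodule.disjoint_def.2 ?_)
  · rw [add_comm, LinearMap.finrank_range_add_finrank_ker]
  · rintro _ hx ⟨y, rfl⟩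
    have hy : y ∈ LinearMap.ker (A ^ (N + N)) := by rwa [pow_add]
    rwa [Module.End.ker_pow_eq_ker_pow_finrank_of_le (hN.trans (Nat.le_add_left N N)),
      ← Module.End.ker_pow_eq_ker_pow_finrank_of_le hN] at hy

theorem disjoint_ker_range_pow {A : Module.End K V} {N : ℕ} (hN : Module.finrank K V ≤ N) :
    Disjoint (LinearMap.ker A) (LinearMap.range (A ^ N)) := by
  refine (isCompl_ker_pow_range_pow A hN).disjoint.mono_left fun x hx => ?_
  rw [Module.End.ker_pow_eq_ker_pow_finrank_of_le hN,
    ← Module.End.ker_pow_eq_ker_pow_finrank_of_le (hN.trans N.le_succ), LinearMap.mem_ker,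
    pow_succ, Module.End.mul_apply, LinearMap.mem_ker.1 hx, map_zero]

end Fitting

section Symplectic

variable {V : Type*} [AddCommGroup V] [Module ℝ V] [FiniteDimensional ℝ V]
  {ω : LinearMap.BilinForm ℝ V} {A : Module.End ℝ V}

theorem even_sigNeg_hamiltonianForm_of_det_pos (hω : ω.IsAlt) (hnd : ω.Nondegenerate)
    (hA : ω.IsSkewAdjoint A) (hdet : 0 < LinearMap.det A) :
    Even (sigNeg (hamiltonianForm ω A)) := by
  obtain ⟨v, hv⟩ := exists_basis_isOrthoᵢ_associated (hamiltonianForm ω A)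
  rw [sigNeg_eq_ncard_of_isOrthoᵢ _ v hv]
  rw [associated_hamiltonianForm hω hA] at hv
  have hdiag : LinearMap.BilinForm.toMatrix v (ω.compLeft A) =
      Matrix.diagonal fun i => hamiltonianForm ω A (v i) := by
    ext i j
    rw [LinearMap.BilinForm.toMatrix_apply]
    obtain rfl | hij := eq_or_ne i j
    · simp
    · rw [Matrix.diagonal_apply_ne _ hij]
      exact hv hij
  apply even_ncard_neg_of_prod_pos
  rw [← Matrix.det_diagonal, ← hdiag, LinearMap.BilinForm.toMatrix_compLeft, Matrix.det_mul,
    Matrix.det_transpose, LinearMap.det_toMatrix]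
  exact mul_pos hdet (det_toMatrix_pos_of_isAlt v hω hnd)

theorem even_sigNeg_hamiltonianForm_restrict_range_pow (hω : ω.IsAlt) (hnd : ω.Nondegenerate)
    (hA : ω.IsSkewAdjoint A) (hneg : ∀ μ < 0, A.eigenspace μ = ⊥) {N : ℕ}
    (hN : Module.finrank ℝ V ≤ N) :
    Even (sigNeg ((hamiltonianForm ω A).restrict (LinearMap.range (A ^ N)))) := by
  rw [hamiltonianForm_restrict (apply_mem_range_pow N)]
  refine even_sigNeg_hamiltonianForm_of_det_pos (fun x => hω x) ?_ (isSkewAdjoint_restrict hA _)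
    (det_pos_of_forall_nonpos_not_hasEigenvalue fun μ hμ hev => hev ?_)
  · refine ω.nondegenerate_restrict_of_disjoint_orthogonal hω.isRefl ?_
    rw [orthogonal_range_pow_eq_ker_pow hnd hA]
    exact (isCompl_ker_pow_range_pow A hN).disjoint.symm
  · refine Module.End.eigenspace_restrict_eq_bot _ ?_
    obtain hμ | rfl := hμ.lt_or_eq
    · exact hneg μ hμ ▸ disjoint_bot_left
    · rw [Module.End.eigenspace_zero]
      exact disjoint_ker_range_pow hN

theorem even_sigNeg_hamiltonianForm_restrict_ker_pow_sub (hω : ω.IsAlt) (hnd : ω.Nondegenerate)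
    (hA : ω.IsSkewAdjoint A) (hneg : ∀ μ < 0, A.eigenspace μ = ⊥) {N : ℕ}
    (hN : Module.finrank ℝ V ≤ N) :
    Even ((sigNeg ((hamiltonianForm ω A).restrict (LinearMap.ker (A ^ N))) : ℤ) -
      sigNeg (hamiltonianForm ω A)) := by
  have horth : ∀ x ∈ LinearMap.ker (A ^ N), ∀ y ∈ LinearMap.range (A ^ N),
      ω.compLeft A x y = 0 := by
    intro x hx y hy
    have hAx : A x ∈ LinearMap.ker (A ^ N) := by
      rw [LinearMap.mem_ker, ← Module.End.mul_apply, ← pow_succ, pow_succ', Module.End.mul_apply,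
        LinearMap.mem_ker.1 hx, map_zero]
    rw [← orthogonal_range_pow_eq_ker_pow hnd hA] at hAx
    exact hω.isRefl _ _ (hAx y hy)
  rw [sigNeg_eq_add_of_isCompl _ (isCompl_ker_pow_range_pow A hN) (by
      rwa [associated_hamiltonianForm hω hA]),
    Nat.cast_add, sub_add_cancel_left, even_neg, Int.even_coe_nat]
  exact even_sigNeg_hamiltonianForm_restrict_range_pow hω hnd hA hneg hN

theorem even_sigNeg_hamiltonianForm_restrict_inf_ker_pow_sub (hω : ω.IsAlt)
    (hA : ω.IsSkewAdjoint A) {E : Submodule ℝ V} (hE : ∀ x ∈ E, A x ∈ E)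
    (hnd : (ω.restrict E).Nondegenerate) (hneg : ∀ μ < 0, Disjoint (A.eigenspace μ) E)
    {N : ℕ} (hN : Module.finrank ℝ E ≤ N) :
    Even ((sigNeg ((hamiltonianForm ω A).restrict (E ⊓ LinearMap.ker (A ^ N))) : ℤ) -
      sigNeg ((hamiltonianForm ω A).restrict E)) := by
  rw [← map_subtype_ker_restrict_pow hE, ← sigNeg_restrict_restrict]
  exact even_sigNeg_hamiltonianForm_restrict_ker_pow_sub (ω := ω.restrict E) (fun x => hω x) hnd
    (isSkewAdjoint_restrict hA hE)
    (fun μ hμ => Module.End.eigenspace_restrict_eq_bot hE (hneg μ hμ)) hN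

end Symplectic

section SymplecticComplement

variable {K V : Type*} [Field K] [AddCommGroup V] [Module K V] {ω : LinearMap.BilinForm K V}

theorem nondegenerate_restrict_orthogonal [FiniteDimensional K V] (hω : ω.IsRefl)
    (hnd : ω.Nondegenerate) {S : Submodule K V} (hS : Disjoint S (ω.orthogonal S)) :
    (ω.restrict (ω.orthogonal S)).Nondegenerate := by
  refine ω.nondegenerate_restrict_of_disjoint_orthogonal hω ?_
  rw [LinearMap.BilinForm.orthogonal_orthogonal hnd hω]
  exact hS.symm

theorem apply_mem_orthogonal_of_isSkewAdjoint {A : Module.End K V} (hA : ω.IsSkewAdjoint A)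
    {S : Submodule K V} (hS : ∀ x ∈ S, A x ∈ S) : ∀ x ∈ ω.orthogonal S, A x ∈ ω.orthogonal S := by
  intro x hx y hy
  have h : ω (A y) x = ω y (-A x) := hA y x
  rw [hx (A y) (hS y hy), map_neg] at h
  exact neg_eq_zero.1 h.symm

end SymplecticComplement

section RankNullity

theorem finrank_add_finrank_map_le_finrank {K V W : Type*} [DivisionRing K] [AddCommGroup V]
    [Module K V] [FiniteDimensional K V] [AddCommGroup W] [Module K W] {S T : Submodule K V}
    {f : V →ₗ[K] W} (hTS : T ≤ S) (hTf : T ≤ LinearMap.ker f) :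
    Module.finrank K T + Module.finrank K (S.map f) ≤ Module.finrank K S := by
  have hker : T.comap S.subtype ≤ LinearMap.ker (f.domRestrict S) := fun x hx => hTf hx
  have hT := (Submodule.comapSubtypeEquivOfLe hTS).finrank_eq
  have hrank := LinearMap.finrank_range_add_finrank_ker (f.domRestrict S)
  rw [LinearMap.range_domRestrict] at hrank
  have := Submodule.finrank_mono hker
  omega

end RankNullity

section ComplexStructure

variable {F : Type*} [NormedAddCommGroup F] [InnerProductSpace ℝ F] {J : F →ₗ[ℝ] F}

theorem inner_apply_left_of_isSkewAdjoint (hJ : (innerₗ F).IsSkewAdjoint J) (x y : F) :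
    inner ℝ (J x) y = -inner ℝ x (J y) :=
  (hJ x y).trans (inner_neg_right x (J y))

theorem inner_self_apply_of_isSkewAdjoint (hJ : (innerₗ F).IsSkewAdjoint J) (x : F) :
    inner ℝ x (J x) = 0 := by
  have h := inner_apply_left_of_isSkewAdjoint hJ x x
  rw [real_inner_comm] at h
  linarith

theorem isSkewAdjoint_smul (hJ : (innerₗ F).IsSkewAdjoint J) (c : ℝ) :
    (innerₗ F).IsSkewAdjoint (c • J : F →ₗ[ℝ] F) :=
  (LinearMap.mem_skewAdjointSubmodule _).1
    (Submodule.smul_mem _ c ((LinearMap.mem_skewAdjointSubmodule _).2 hJ))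

theorem norm_apply_of_apply_apply_eq_neg (hJ : (innerₗ F).IsSkewAdjoint J)
    (hJJ : ∀ x, J (J x) = -x) (x : F) : ‖J x‖ = ‖x‖ := by
  rw [norm_eq_sqrt_real_inner, norm_eq_sqrt_real_inner, inner_apply_left_of_isSkewAdjoint hJ, hJJ,
    inner_neg_right, neg_neg]

variable {P : Submodule ℝ F}

theorem apply_mem_orthogonal_of_forall_mem (hJ : (innerₗ F).IsSkewAdjoint J)
    (hP : ∀ x ∈ P, J x ∈ P) : ∀ x ∈ Pᗮ, J x ∈ Pᗮ := by
  intro x hx y hy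
  rw [← neg_eq_zero, ← inner_apply_left_of_isSkewAdjoint hJ]
  exact hx (J y) (hP y hy)

theorem starProjection_apply_of_isSkewAdjoint [P.HasOrthogonalProjection]
    (hJ : (innerₗ F).IsSkewAdjoint J) (hP : ∀ x ∈ P, J x ∈ P) (x : F) :
    P.starProjection (J x) = J (P.starProjection x) := by
  refine Submodule.eq_starProjection_of_mem_of_inner_eq_zero
    (hP _ (P.starProjection_apply_mem x)) fun w hw => ?_
  rw [← map_sub, inner_apply_left_of_isSkewAdjoint hJ, P.starProjection_inner_eq_zero x _ (hP w hw),
    neg_zero]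

theorem isSkewAdjoint_comp_starProjection [P.HasOrthogonalProjection]
    (hJ : (innerₗ F).IsSkewAdjoint J) (hP : ∀ x ∈ P, J x ∈ P) :
    (innerₗ F).IsSkewAdjoint (J ∘ₗ P.starProjection.toLinearMap) := fun x y => by
  have h : inner ℝ (J (P.starProjection x)) y = -inner ℝ x (J (P.starProjection y)) := by
    rw [← starProjection_apply_of_isSkewAdjoint hJ hP, P.inner_starProjection_left_eq_right,
      inner_apply_left_of_isSkewAdjoint hJ]
  exact h.trans (inner_neg_right _ _).symm

theorem span_pair_apply_eq_of_finrank_le_two (hJ : (innerₗ F).IsSkewAdjoint J)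
    (hJJ : ∀ x, J (J x) = -x) [FiniteDimensional ℝ P] (hP : ∀ x ∈ P, J x ∈ P)
    (hfin : Module.finrank ℝ P ≤ 2) {e : F} (he : e ∈ P) (he0 : e ≠ 0) :
    Submodule.span ℝ {e, J e} = P := by
  have hli : LinearIndependent ℝ ![e, J e] := by
    refine linearIndependent_of_ne_zero_of_inner_eq_zero (fun i => ?_) fun i j hij => ?_
    · fin_cases i
      · exact he0
      · exact norm_ne_zero_iff.1
          ((norm_apply_of_apply_apply_eq_neg hJ hJJ e).trans_ne (norm_ne_zero_iff.2 he0))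
    · have heJe := inner_self_apply_of_isSkewAdjoint hJ e
      fin_cases i <;> fin_cases j
      · exact absurd rfl hij
      · exact heJe
      · exact (real_inner_comm _ _).trans heJe
      · exact absurd rfl hij
  refine Submodule.eq_of_le_of_finrank_le (Submodule.span_le.2 ?_) (hfin.trans ?_)
  · exact Set.insert_subset he (Set.singleton_subset_iff.2 (hP e he))
  · have := finrank_span_eq_card hli
    rw [Matrix.range_cons_cons_empty, Fintype.card_fin] at this
    exact this.ge

theorem exists_forall_starProjection_apply_eq_smul (hJ : (innerₗ F).IsSkewAdjoint J)
    (hJJ : ∀ x, J (J x) = -x) [FiniteDimensional ℝ P] (hP : ∀ x ∈ P, J x ∈ P)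
    (hfin : Module.finrank ℝ P ≤ 2) {b : F →ₗ[ℝ] F} (hb : (innerₗ F).IsSkewAdjoint b) :
    ∃ c : ℝ, ∀ x ∈ P, P.starProjection (b x) = c • J x := by
  rcases eq_or_ne P ⊥ with rfl | hbot
  · exact ⟨0, by simp⟩
  obtain ⟨e, he, he0⟩ := P.exists_mem_ne_zero_of_ne_bot hbot
  have hspan := span_pair_apply_eq_of_finrank_le_two hJ hJJ hP hfin he he0
  have hee : inner ℝ e e ≠ (0 : ℝ) := inner_self_ne_zero.2 he0
  have heJe : inner ℝ e (J e) = 0 := inner_self_apply_of_isSkewAdjoint hJ e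
  have hJee : inner ℝ (J e) e = 0 := (real_inner_comm _ _).trans heJe
  have hJeJe : inner ℝ (J e) (J e) = inner ℝ e e := by
    rw [inner_apply_left_of_isSkewAdjoint hJ, hJJ, inner_neg_right, neg_neg]
  have hbee : inner ℝ (b e) e = 0 :=
    (real_inner_comm _ _).trans (inner_self_apply_of_isSkewAdjoint hb e)
  have hbJeJe : inner ℝ (b (J e)) (J e) = 0 :=
    (real_inner_comm _ _).trans (inner_self_apply_of_isSkewAdjoint hb (J e))
  have hbJee : inner ℝ (b (J e)) e = -inner ℝ (b e) (J e) := by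
    rw [inner_apply_left_of_isSkewAdjoint hb, real_inner_comm]
  refine ⟨inner ℝ (b e) (J e) / inner ℝ e e, fun x hx => ?_⟩
  refine P.eq_starProjection_of_mem_of_inner_eq_zero (P.smul_mem _ (hP x hx)) fun w hw => ?_
  rw [← hspan] at hx hw
  obtain ⟨α, β, rfl⟩ := Submodule.mem_span_pair.1 hx
  obtain ⟨s, t, rfl⟩ := Submodule.mem_span_pair.1 hw
  simp only [map_add, map_smul, inner_add_left, inner_add_right, inner_sub_left,
    real_inner_smul_left, real_inner_smul_right, hJJ, inner_neg_left, heJe, hJee, hJeJe, hbee,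
    hbJeJe, hbJee]
  field_simp
  ring

/-- The isometry which fixes a `J`-invariant subspace `P` pointwise and is `J` on `Pᗮ`, where `J`
is an orthogonal complex structure. -/
noncomputable def quarterTurn [FiniteDimensional ℝ F] (hJ : (innerₗ F).IsSkewAdjoint J)
    (hJJ : ∀ x, J (J x) = -x) (hP : ∀ x ∈ P, J x ∈ P) : F ≃ₗᵢ[ℝ] F :=
  LinearIsometry.toLinearIsometryEquiv
    { toLinearMap := P.starProjection.toLinearMap + J ∘ₗ Pᗮ.starProjection.toLinearMap
      norm_map' := fun x => by
        have horth : inner ℝ (P.starProjection x) (J (Pᗮ.starProjection x)) = 0 :=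
          apply_mem_orthogonal_of_forall_mem hJ hP _ (Pᗮ.starProjection_apply_mem x) _
            (P.starProjection_apply_mem x)
        have hsq := norm_add_sq_eq_norm_sq_add_norm_sq_real horth
        rw [norm_apply_of_apply_apply_eq_neg hJ hJJ, ← sq, ← sq, ← sq,
          ← Submodule.norm_sq_eq_add_norm_sq_starProjection] at hsq
        exact (sq_eq_sq₀ (norm_nonneg _) (norm_nonneg _)).1 hsq }
    rfl

theorem quarterTurn_apply [FiniteDimensional ℝ F] (hJ : (innerₗ F).IsSkewAdjoint J)
    (hJJ : ∀ x, J (J x) = -x) (hP : ∀ x ∈ P, J x ∈ P) (x : F) :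
    quarterTurn hJ hJJ hP x = P.starProjection x + J (Pᗮ.starProjection x) := rfl

end ComplexStructure

namespace RelEq

variable {n : ℕ} {m : Fin n → ℝ} {q : Config n} {a : E4 →ₗ[ℝ] E4}

section BlockOperators

@[simp]
theorem diagAct_apply (a : E4 →ₗ[ℝ] E4) (x : Config n) (i : Fin n) :
    diagAct a x i = a (x i) := rfl

@[simp]
theorem massOp_apply (m : Fin n → ℝ) (x : Config n) (i : Fin n) :
    massOp m x i = m i • x i := rfl

theorem massInv_eq_massOp_inv (m : Fin n → ℝ) : massInv m = massOp m⁻¹ := rfl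

theorem massInv_massOp (hm : ∀ i, m i ≠ 0) (x : Config n) : massInv m (massOp m x) = x := by
  ext1 i
  simp [massInv_eq_massOp_inv, hm i]

theorem massOp_injective (hm : ∀ i, m i ≠ 0) : Function.Injective (massOp m) :=
  Function.LeftInverse.injective (massInv_massOp hm)

theorem diagAct_massOp (m : Fin n → ℝ) (a : E4 →ₗ[ℝ] E4) (x : Config n) :
    diagAct a (massOp m x) = massOp m (diagAct a x) := by
  ext1 i
  simp

theorem inner_massOp_left (m : Fin n → ℝ) (x y : Config n) :
    inner ℝ (massOp m x) y = ∑ i, m i * inner ℝ (x i) (y i) := by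
  rw [PiLp.inner_apply]
  simp only [massOp_apply, real_inner_smul_left]

theorem massOp_isSymmetric (m : Fin n → ℝ) : (massOp m).IsSymmetric := fun x y => by
  rw [inner_massOp_left, ← real_inner_comm, inner_massOp_left]
  simp only [real_inner_comm]

theorem eq_zero_of_inner_massOp_self_eq_zero (hm : ∀ i, 0 < m i) {x : Config n}
    (h : inner ℝ (massOp m x) x = 0) : x = 0 := by
  rw [inner_massOp_left, Finset.sum_eq_zero_iff_of_nonneg fun i _ =>
    mul_nonneg (hm i).le real_inner_self_nonneg] at h
  ext1 i
  exact inner_self_eq_zero.1 ((mul_eq_zero.1 (h i (Finset.mem_univ i))).resolve_left (hm i).ne')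

theorem isSkewAdjoint_diagAct (ha : (innerₗ E4).IsSkewAdjoint a) :
    (innerₗ (Config n)).IsSkewAdjoint (diagAct a) := fun x y => by
  simp [PiLp.inner_apply, inner_apply_left_of_isSkewAdjoint ha]

end BlockOperators

section PhaseSpace

theorem omega_apply (z w : Phase n) : omega z w = inner ℝ z.1 w.2 - inner ℝ z.2 w.1 := by
  rw [sub_eq_neg_add, ← inner_neg_left]
  rfl

theorem omega_isAlt : (omega (n := n)).IsAlt := fun z => by
  rw [omega_apply, real_inner_comm, sub_self]

theorem omega_nondegenerate : (omega (n := n)).Nondegenerate := by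
  refine omega_isAlt.isRefl.nondegenerate_iff_separatingLeft.2 fun z hz => ?_
  have h1 := hz (-z.2, 0)
  have h2 := hz (0, z.1)
  simp only [omega_apply, inner_neg_right, inner_zero_right, sub_neg_eq_add, zero_add, sub_zero,
    inner_self_eq_zero] at h1 h2
  exact Prod.ext h2 h1

theorem hamL_apply (m : Fin n → ℝ) (q : Config n) (a : E4 →ₗ[ℝ] E4) (z : Phase n) :
    hamL m q a z = (diagAct a z.1 + massInv m z.2, hessU m q z.1 + diagAct a z.2) := rfl

theorem isSkewAdjoint_hamL (hH : (hessU m q).IsSymmetric) (ha : (innerₗ E4).IsSkewAdjoint a) :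
    omega.IsSkewAdjoint (hamL m q a) := fun z w => by
  simp only [omega_apply, hamL_apply, Pi.neg_apply, Prod.fst_neg, Prod.snd_neg, inner_add_left,
    inner_add_right, inner_neg_right, hH _ _, massInv_eq_massOp_inv, massOp_isSymmetric m⁻¹ _ _,
    inner_apply_left_of_isSkewAdjoint (isSkewAdjoint_diagAct ha)]
  ring

theorem formB_eq_hamiltonianForm (m : Fin n → ℝ) (q : Config n) (a : E4 →ₗ[ℝ] E4) :
    formB m q a = hamiltonianForm omega (hamL m q a) := rfl

theorem ker_stdJ_comp_matB_pow (m : Fin n → ℝ) (q : Config n) (a : E4 →ₗ[ℝ] E4) (N : ℕ) :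
    LinearMap.ker ((stdJ ∘ₗ matB m q a) ^ N) = LinearMap.ker (hamL m q a ^ N) := by
  have h : (stdJ ∘ₗ matB m q a) ^ N = (-1 : Module.End ℝ (Phase n)) ^ N * hamL m q a ^ N :=
    neg_pow (hamL m q a : Module.End ℝ (Phase n)) N
  rw [h]
  rcases neg_one_pow_eq_or (Module.End ℝ (Phase n)) N with h | h <;> rw [h] <;> ext z <;> simp

theorem finrank_phase : Module.finrank ℝ (Phase n) = 8 * n := by
  have : Module.finrank ℝ (Config n) = 4 * n := by
    rw [(WithLp.linearEquiv 2 ℝ (Fin n → E4)).finrank_eq, Module.finrank_pi_fintype]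
    simp [mul_comm]
  rw [Module.finrank_prod]
  omega

end PhaseSpace

section PhaseOver

/-- The subspace `T × M T` of the phase space spanned by the positions in `T` and the momenta of
the velocities in `T`. The subspaces `E₁`, `E₂ᵈ` and `E₂ˢ` are of this form. -/
noncomputable def phaseOver (m : Fin n → ℝ) (T : Submodule ℝ (Config n)) :
    Submodule ℝ (Phase n) :=
  T.prod (T.map (massOp m))

theorem phaseOver_sup (m : Fin n → ℝ) (T S : Submodule ℝ (Config n)) :
    phaseOver m (T ⊔ S) = phaseOver m T ⊔ phaseOver m S := by
  rw [phaseOver, phaseOver, phaseOver, Submodule.prod_sup_prod, Submodule.map_sup]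

theorem phaseOver_span (m : Fin n → ℝ) (s : Set (Config n)) :
    phaseOver m (Submodule.span ℝ s) =
      Submodule.span ℝ {z | ∃ x ∈ s, z = (x, 0) ∨ z = (0, massOp m x)} := by
  have hset : {z : Phase n | ∃ x ∈ s, z = (x, 0) ∨ z = (0, massOp m x)} =
      LinearMap.inl ℝ (Config n) (Config n) '' s ∪
        LinearMap.inr ℝ (Config n) (Config n) '' (massOp m '' s) := by
    ext z
    simp [eq_comm, and_or_left, exists_or]
  rw [hset, phaseOver, Submodule.map_span, ← LinearMap.span_inl_union_inr]

theorem finrank_phaseOver (hm : ∀ i, m i ≠ 0) (T : Submodule ℝ (Config n)) :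
    Module.finrank ℝ (phaseOver m T) = 2 * Module.finrank ℝ T := by
  have hrange : phaseOver m T = LinearMap.range (T.subtype.prodMap (massOp m ∘ₗ T.subtype)) := by
    rw [LinearMap.range_prodMap, LinearMap.range_comp, Submodule.range_subtype, phaseOver]
  have hinj : Function.Injective (T.subtype.prodMap (massOp m ∘ₗ T.subtype)) :=
    T.subtype_injective.prodMap ((massOp_injective hm).comp T.subtype_injective)
  rw [hrange, LinearMap.finrank_range_of_inj hinj, Module.finrank_prod, two_mul]

theorem disjoint_phaseOver_orthogonal (hm : ∀ i, 0 < m i) (T : Submodule ℝ (Config n)) :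
    Disjoint (phaseOver m T) (omega.orthogonal (phaseOver m T)) := by
  rw [Submodule.disjoint_def]
  rintro ⟨x, p⟩ ⟨hx, ⟨y, hy, rfl : massOp m y = p⟩⟩ h
  have hyy := h (y, 0) ⟨hy, Submodule.zero_mem _⟩
  have hxx := h (0, massOp m x) ⟨Submodule.zero_mem _, Submodule.mem_map_of_mem hx⟩
  simp only [omega_apply, inner_zero_left, sub_zero, zero_sub, neg_eq_zero] at hyy hxx
  rw [← massOp_isSymmetric m y y] at hyy
  rw [eq_zero_of_inner_massOp_self_eq_zero hm hyy, eq_zero_of_inner_massOp_self_eq_zero hm hxx,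
    map_zero]
  rfl

theorem hamL_mem_phaseOver (hm : ∀ i, m i ≠ 0) {T : Submodule ℝ (Config n)}
    (haT : ∀ x ∈ T, diagAct a x ∈ T) (hHT : ∀ x ∈ T, hessU m q x ∈ T.map (massOp m)) :
    ∀ z ∈ phaseOver m T, hamL m q a z ∈ phaseOver m T := by
  rintro ⟨x, p⟩ ⟨hx, ⟨y, hy, rfl : massOp m y = p⟩⟩
  rw [hamL_apply, massInv_massOp hm, diagAct_massOp]
  exact ⟨T.add_mem (haT x hx) hy,
    Submodule.add_mem _ (hHT x hx) (Submodule.mem_map_of_mem (haT y hy))⟩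

end PhaseOver

section Stability

theorem IsStableOn.disjoint_eigenspace {L : Module.End ℝ (Phase n)} {E : Submodule ℝ (Phase n)}
    (h : IsStableOn L E) {μ : ℝ} (hμ : μ ≠ 0) : Disjoint (L.eigenspace μ) E := by
  refine Submodule.disjoint_def.2 fun z hL hz => by_contra fun hz0 => hμ ?_
  rw [← Complex.ofReal_re μ]
  refine h μ ⟨1 ⊗ₜ z, Submodule.tmul_mem_baseChange_of_mem 1 hz, fun h0 => hz0 ?_, ?_⟩
  · simpa using congrArg (TensorProduct.lid ℝ (Phase n) ∘ Complex.reLm.rTensor (Phase n)) h0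
  · rw [LinearMap.baseChange_tmul, Module.End.mem_eigenspace_iff.1 hL, TensorProduct.tmul_smul,
      TensorProduct.smul_tmul', TensorProduct.smul_tmul', smul_eq_mul, mul_one, Complex.real_smul,
      mul_one]

theorem IsStableOn.even_indexB3Ker_sub_indexB3 {T : Submodule ℝ (Config n)}
    (hstable : IsStableOn (hamL m q a) (omega.orthogonal (phaseOver m T))) (hm : ∀ i, 0 < m i)
    (hH : (hessU m q).IsSymmetric) (ha : (innerₗ E4).IsSkewAdjoint a)
    (haT : ∀ x ∈ T, diagAct a x ∈ T) (hHT : ∀ x ∈ T, hessU m q x ∈ T.map (massOp m))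
    {N : ℕ} (hN : 8 * n ≤ N + 2 * Module.finrank ℝ T) :
    Even ((indexB3Ker m q a (omega.orthogonal (phaseOver m T)) N : ℤ) -
      indexB3 m q a (omega.orthogonal (phaseOver m T))) := by
  have hm' : ∀ i, m i ≠ 0 := fun i => (hm i).ne'
  have hskew := isSkewAdjoint_hamL hH ha
  rw [indexB3Ker, indexB3, ker_stdJ_comp_matB_pow, formB_eq_hamiltonianForm]
  refine even_sigNeg_hamiltonianForm_restrict_inf_ker_pow_sub omega_isAlt hskew
    (apply_mem_orthogonal_of_isSkewAdjoint hskew (hamL_mem_phaseOver hm' haT hHT))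
    (nondegenerate_restrict_orthogonal omega_isAlt.isRefl omega_nondegenerate
      (disjoint_phaseOver_orthogonal hm T))
    (fun μ hμ => hstable.disjoint_eigenspace hμ.ne) ?_
  rw [LinearMap.BilinForm.finrank_orthogonal omega_nondegenerate, finrank_phase,
    finrank_phaseOver hm']
  omega

end Stability

end RelEq

section Gradient

variable {F : Type*} [NormedAddCommGroup F] [InnerProductSpace ℝ F] [CompleteSpace F]
  {U : F → ℝ} {q : F}

theorem differentiableAt_gradient (hU : ContDiffAt ℝ 2 U q) :
    DifferentiableAt ℝ (gradient U) q :=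
  (InnerProductSpace.toDual ℝ F).symm.toContinuousLinearEquiv.differentiableAt.comp q
    ((hU.fderiv_right (m := 1) (by norm_num)).differentiableAt one_ne_zero)

theorem inner_fderiv_gradient (hU : ContDiffAt ℝ 2 U q) (x y : F) :
    inner ℝ (fderiv ℝ (gradient U) q x) y = fderiv ℝ (fderiv ℝ U) q x y := by
  have hU' : DifferentiableAt ℝ (fderiv ℝ U) q :=
    (hU.fderiv_right (m := 1) (by norm_num)).differentiableAt one_ne_zero
  have hgrad : fderiv ℝ (gradient U) q = _ :=
    ((InnerProductSpace.toDual ℝ F).symm.toContinuousLinearEquiv.hasFDerivAt.comp q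
      hU'.hasFDerivAt).fderiv
  rw [hgrad]
  exact InnerProductSpace.toDual_symm_apply

theorem inner_fderiv_gradient_comm (hU : ContDiffAt ℝ 2 U q) (x y : F) :
    inner ℝ (fderiv ℝ (gradient U) q x) y = inner ℝ x (fderiv ℝ (gradient U) q y) := by
  rw [inner_fderiv_gradient hU, real_inner_comm, inner_fderiv_gradient hU]
  exact hU.isSymmSndFDerivAt (by simp) x y

theorem inner_fderiv_gradient_of_eventually_eq_const_mul (hU : ContDiffAt ℝ 2 U q) {B : F → F}
    {B' : F →L[ℝ] F} (hB : HasFDerivAt B B' q) (c : ℝ)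
    (h : ∀ᶠ x in nhds q, fderiv ℝ U x (B x) = c * U x) (y : F) :
    inner ℝ (fderiv ℝ (gradient U) q (B q)) y =
      c * inner ℝ (gradient U q) y - inner ℝ (gradient U q) (B' y) := by
  have hleft := (differentiableAt_gradient hU).hasFDerivAt.inner ℝ hB
  have hright : HasFDerivAt (fun x => c * U x) (c • fderiv ℝ U q) q :=
    (hU.differentiableAt two_ne_zero).hasFDerivAt.const_mul c
  have heq : (fun x => inner ℝ (gradient U x) (B x)) =ᶠ[nhds q] fun x => c * U x := by
    simp only [inner_gradient_left]
    exact h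
  have hderiv := DFunLike.congr_fun (hleft.unique (hright.congr_of_eventuallyEq heq)) y
  simp only [ContinuousLinearMap.comp_apply, ContinuousLinearMap.prod_apply, fderivInnerCLM_apply,
    smul_apply, smul_eq_mul, ← inner_gradient_left] at hderiv
  rw [inner_fderiv_gradient_comm hU, real_inner_comm, ← hderiv, add_sub_cancel_left]

theorem inner_fderiv_gradient_of_eventually_eq_zero [FiniteDimensional ℝ F]
    (hU : ContDiffAt ℝ 2 U q) (B : F →ₗ[ℝ] F) (h : ∀ᶠ x in nhds q, fderiv ℝ U x (B x) = 0)
    (y : F) : inner ℝ (fderiv ℝ (gradient U) q (B q)) y = -inner ℝ (gradient U q) (B y) := by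
  simpa using inner_fderiv_gradient_of_eventually_eq_const_mul hU
    (LinearMap.toContinuousLinearMap B).hasFDerivAt 0 (by simpa using h) y

theorem gradient_comp_linearIsometryEquiv (U : F → ℝ) (G : F ≃ₗᵢ[ℝ] F) (x : F) :
    gradient (U ∘ G) x = G.symm (gradient U (G x)) := by
  refine ext_inner_right ℝ fun y => ?_
  have hchain : fderiv ℝ (U ∘ G) x = _ := G.toContinuousLinearEquiv.comp_right_fderiv
  rw [LinearIsometryEquiv.inner_map_eq_flip, LinearIsometryEquiv.symm_symm, inner_gradient_left,
    inner_gradient_left, hchain]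
  rfl

theorem fderiv_gradient_linearIsometryEquiv {G : F ≃ₗᵢ[ℝ] F} (hU : U ∘ G = U) (hG : G q = q)
    (x : F) : fderiv ℝ (gradient U) q (G x) = G (fderiv ℝ (gradient U) q x) := by
  have hgrad : gradient U ∘ G = G ∘ gradient U := by
    ext1 y
    have h := gradient_comp_linearIsometryEquiv U G y
    rw [hU] at h
    rw [Function.comp_apply, Function.comp_apply, h, LinearIsometryEquiv.apply_symm_apply]
  have hright : fderiv ℝ (gradient U ∘ G) q = _ := G.toContinuousLinearEquiv.comp_right_fderiv
  have hleft : fderiv ℝ (G ∘ gradient U) q = _ := G.toContinuousLinearEquiv.comp_fderiv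
  have h := DFunLike.congr_fun (hright.symm.trans ((congrArg (fderiv ℝ · q) hgrad).trans hleft)) x
  have h' : fderiv ℝ (gradient U) (G q) (G x) = G (fderiv ℝ (gradient U) q x) := h
  rwa [hG] at h'

end Gradient

namespace RelEq

variable {n : ℕ} {m : Fin n → ℝ} {q : Config n} {a : E4 →ₗ[ℝ] E4}

section Potential

theorem contDiffAt_potential (m : Fin n → ℝ) {x : Config n} (hx : ∀ i j, i ≠ j → x i ≠ x j)
    (k : WithTop ℕ∞) : ContDiffAt ℝ k (potential m) x := by
  unfold potential
  refine ContDiffAt.sum fun i _ => ContDiffAt.sum fun j hj => ?_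
  have hij : x i - x j ≠ 0 := sub_ne_zero.2 (hx i j (Finset.mem_Ioi.1 hj).ne)
  have hd : ContDiffAt ℝ k (fun x : Config n => x i - x j) x := by fun_prop
  exact contDiffAt_const.div (hd.norm ℝ hij) (norm_ne_zero_iff.2 hij)

theorem hasDerivAt_const_div_norm_add_smul {F : Type*} [NormedAddCommGroup F]
    [InnerProductSpace ℝ F] {d : F} (hd : d ≠ 0) (v : F) (c : ℝ) :
    HasDerivAt (fun t : ℝ => c / ‖d + t • v‖) (-(c * inner ℝ d v / ‖d‖ ^ 3)) 0 := by
  have hline : HasDerivAt (fun t : ℝ => d + t • v) v 0 := by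
    simpa using ((hasDerivAt_id (0 : ℝ)).smul_const v).const_add d
  have hnorm := hline.norm_sq.sqrt (by simpa using hd)
  simp only [Real.sqrt_sq (norm_nonneg _), zero_smul, add_zero] at hnorm
  have hinv := (hasDerivAt_const (0 : ℝ) c).div hnorm (by simpa using hd)
  simp only [zero_smul, add_zero] at hinv
  have hd' : ‖d‖ ≠ 0 := norm_ne_zero_iff.2 hd
  convert! hinv using 1
  field_simp
  ring

theorem fderiv_potential (m : Fin n → ℝ) {x : Config n} (hx : ∀ i j, i ≠ j → x i ≠ x j)
    (y : Config n) : fderiv ℝ (potential m) x y =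
      ∑ i, ∑ j ∈ Finset.Ioi i,
        -(m i * m j * inner ℝ (x i - x j) (y i - y j) / ‖x i - x j‖ ^ 3) := by
  have hline :=
    ((contDiffAt_potential m hx 1).differentiableAt one_ne_zero).hasFDerivAt.hasLineDerivAt y
  refine HasDerivAt.unique hline ?_
  unfold potential
  refine HasDerivAt.fun_sum fun i _ => HasDerivAt.fun_sum fun j hj => ?_
  have hij : x i - x j ≠ 0 := sub_ne_zero.2 (hx i j (Finset.mem_Ioi.1 hj).ne)
  convert! hasDerivAt_const_div_norm_add_smul hij (y i - y j) (m i * m j) using 3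
  simp only [PiLp.add_apply, PiLp.smul_apply, smul_sub, add_sub_add_comm]

theorem eventually_collisionFree (hq : ∀ i j, i ≠ j → q i ≠ q j) :
    ∀ᶠ x in nhds q, ∀ i j, i ≠ j → x i ≠ x j := by
  simp only [Filter.eventually_all]
  intro i j hij
  have hd : ContinuousAt (fun x : Config n => x i - x j) q := by fun_prop
  filter_upwards [hd.eventually_ne (sub_ne_zero.2 (hq i j hij))] with x hx using sub_ne_zero.1 hx

theorem fderiv_potential_self (m : Fin n → ℝ) {x : Config n} (hx : ∀ i j, i ≠ j → x i ≠ x j) :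
    fderiv ℝ (potential m) x x = -1 * potential m x := by
  simp only [fderiv_potential m hx, potential, Finset.mul_sum, real_inner_self_eq_norm_sq]
  refine Finset.sum_congr rfl fun i _ => Finset.sum_congr rfl fun j hj => ?_
  have hij : ‖x i - x j‖ ≠ 0 :=
    norm_ne_zero_iff.2 (sub_ne_zero.2 (hx i j (Finset.mem_Ioi.1 hj).ne))
  field_simp

theorem fderiv_potential_diagAct (m : Fin n → ℝ) (ha : (innerₗ E4).IsSkewAdjoint a)
    {x : Config n} (hx : ∀ i j, i ≠ j → x i ≠ x j) :
    fderiv ℝ (potential m) x (diagAct a x) = 0 := by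
  have hskew : ∀ v : E4, inner ℝ v (a v) = 0 := fun v => by
    have := inner_apply_left_of_isSkewAdjoint ha v v
    rw [real_inner_comm] at this
    linarith
  rw [fderiv_potential m hx]
  refine Finset.sum_eq_zero fun i _ => Finset.sum_eq_zero fun j _ => ?_
  rw [diagAct_apply, diagAct_apply, ← map_sub, hskew, mul_zero, zero_div, neg_zero]

theorem hessU_isSymmetric (m : Fin n → ℝ) (hq : ∀ i j, i ≠ j → q i ≠ q j) :
    (hessU m q).IsSymmetric :=
  inner_fderiv_gradient_comm (contDiffAt_potential m hq 2)

theorem inner_hessU_of_fderiv_potential_eq (m : Fin n → ℝ) (hq : ∀ i j, i ≠ j → q i ≠ q j)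
    {B : Config n → Config n} {B' : Config n →L[ℝ] Config n} (hB : HasFDerivAt B B' q) (c : ℝ)
    (h : ∀ x : Config n, (∀ i j, i ≠ j → x i ≠ x j) →
      fderiv ℝ (potential m) x (B x) = c * potential m x) (y : Config n) :
    inner ℝ (hessU m q (B q)) y =
      c * inner ℝ (gradient (potential m) q) y - inner ℝ (gradient (potential m) q) (B' y) :=
  inner_fderiv_gradient_of_eventually_eq_const_mul (contDiffAt_potential m hq 2) hB c
    ((eventually_collisionFree hq).mono h) y

theorem hessU_const (m : Fin n → ℝ) (hq : ∀ i j, i ≠ j → q i ≠ q j) (v : E4) :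
    hessU m q (WithLp.toLp 2 fun _ => v) = 0 := by
  refine ext_inner_right ℝ fun y => ?_
  rw [inner_hessU_of_fderiv_potential_eq m hq
    (hasFDerivAt_const (WithLp.toLp 2 fun _ => v : Config n) q) 0 fun x hx => by
      simp [fderiv_potential m hx]]
  simp

theorem hessU_self (m : Fin n → ℝ) (hq : ∀ i j, i ≠ j → q i ≠ q j) :
    hessU m q q = (-2 : ℝ) • gradient (potential m) q := by
  refine ext_inner_right ℝ fun y => ?_
  refine (inner_hessU_of_fderiv_potential_eq m hq (hasFDerivAt_id q) (-1)
    (fun x => fderiv_potential_self m) y).trans ?_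
  rw [ContinuousLinearMap.id_apply, real_inner_smul_left]
  ring

theorem hessU_diagAct_self (m : Fin n → ℝ) (hq : ∀ i j, i ≠ j → q i ≠ q j)
    (ha : (innerₗ E4).IsSkewAdjoint a) :
    hessU m q (diagAct a q) = diagAct a (gradient (potential m) q) := by
  refine ext_inner_right ℝ fun y => ?_
  rw [inner_apply_left_of_isSkewAdjoint (isSkewAdjoint_diagAct ha)]
  exact inner_fderiv_gradient_of_eventually_eq_zero (contDiffAt_potential m hq 2) (diagAct a)
    ((eventually_collisionFree hq).mono fun x => fderiv_potential_diagAct m ha) y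

theorem potential_diagAct_linearIsometryEquiv (m : Fin n → ℝ) (R : E4 ≃ₗᵢ[ℝ] E4) (x : Config n) :
    potential m (diagAct R.toLinearMap x) = potential m x := by
  simp only [potential, diagAct_apply, ← map_sub]
  simp only [LinearEquiv.coe_coe, LinearIsometryEquiv.coe_toLinearEquiv,
    LinearIsometryEquiv.norm_map]

theorem hessU_diagAct_linearIsometryEquiv (m : Fin n → ℝ) {R : E4 ≃ₗᵢ[ℝ] E4}
    (hR : ∀ i, R (q i) = q i) (x : Config n) :
    hessU m q (diagAct R.toLinearMap x) = diagAct R.toLinearMap (hessU m q x) :=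
  fderiv_gradient_linearIsometryEquiv
    (G := LinearIsometryEquiv.piLpCongrRight 2 fun _ => R)
    (funext (potential_diagAct_linearIsometryEquiv m R)) (by ext1 i; exact hR i) x

end Potential

section Quaternions

theorem isSkewAdjoint_toEuclideanLin {A : Matrix (Fin 4) (Fin 4) ℝ} (hA : A.transpose = -A) :
    (innerₗ E4).IsSkewAdjoint (Matrix.toEuclideanLin A) := fun x y => by
  have hadj :=
    (LinearMap.eq_adjoint_iff _ _).1 (Matrix.toEuclideanLin_conjTranspose_eq_adjoint A) y x
  rw [Matrix.conjTranspose_eq_transpose_of_trivial, hA, map_neg] at hadj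
  simpa [real_inner_comm] using hadj.symm

theorem transpose_quatI : quatI.transpose = -quatI := by
  ext i j; fin_cases i <;> fin_cases j <;> simp [quatI]

theorem transpose_quatJ : quatJ.transpose = -quatJ := by
  ext i j; fin_cases i <;> fin_cases j <;> simp [quatJ]

theorem transpose_quatK : quatK.transpose = -quatK := by
  ext i j; fin_cases i <;> fin_cases j <;> simp [quatK]

theorem transpose_genRot (l r : Fin 4) : (genRot l r).transpose = -genRot l r := by
  simp [genRot, Matrix.transpose_sub, Matrix.transpose_single]

theorem quatI_mul_quatI : quatI * quatI = -1 := by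
  ext i j; fin_cases i <;> fin_cases j <;> simp [quatI, Matrix.mul_apply, Fin.sum_univ_four]

theorem quatI_mul_quatJ : quatI * quatJ = quatK := by
  ext i j
  fin_cases i <;> fin_cases j <;>
    simp [quatI, quatJ, quatK, Matrix.mul_apply, Fin.sum_univ_four]

theorem quatI_mul_quatK : quatI * quatK = -quatJ := by
  rw [← quatI_mul_quatJ, ← mul_assoc, quatI_mul_quatI, neg_one_mul]

/-- Left multiplication by the quaternion unit `i`, an orthogonal complex structure on `ℝ⁴`. -/
noncomputable def opI : Module.End ℝ E4 := Matrix.toEuclideanLin quatI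

/-- The real vector space spanned by the left multiplications by `1`, `i`, `j`, `k`. -/
noncomputable def quaternions : Submodule ℝ (Module.End ℝ E4) :=
  Submodule.span ℝ (Matrix.toEuclideanLin '' {1, quatI, quatJ, quatK})

/-- The Lie algebra of the group of linear similarities of `ℝ⁴`. -/
noncomputable def similarities : Submodule ℝ (Module.End ℝ E4) :=
  Submodule.span ℝ {1} ⊔ (innerₗ E4).skewAdjointSubmodule

theorem toEuclideanLin_one : Matrix.toEuclideanLin 1 = (1 : Module.End ℝ E4) := by
  ext; simp

theorem toEuclideanLin_mul (A B : Matrix (Fin 4) (Fin 4) ℝ) :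
    Matrix.toEuclideanLin (A * B) = (Matrix.toEuclideanLin A * Matrix.toEuclideanLin B :
      Module.End ℝ E4) := by
  ext1 x
  simp

theorem one_mem_quaternions : 1 ∈ quaternions :=
  Submodule.subset_span ⟨1, by simp, toEuclideanLin_one⟩

theorem one_mem_similarities : 1 ∈ similarities :=
  Submodule.mem_sup_left (Submodule.mem_span_singleton_self 1)

theorem mem_similarities_of_isSkewAdjoint {a : Module.End ℝ E4}
    (ha : (innerₗ E4).IsSkewAdjoint a) : a ∈ similarities :=
  Submodule.mem_sup_right ((LinearMap.mem_skewAdjointSubmodule _).2 ha)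

theorem quaternions_le_similarities : quaternions ≤ similarities := by
  refine Submodule.span_le.2 ?_
  rintro _ ⟨_, rfl | rfl | rfl | rfl, rfl⟩
  · exact toEuclideanLin_one ▸ one_mem_similarities
  · exact mem_similarities_of_isSkewAdjoint (isSkewAdjoint_toEuclideanLin transpose_quatI)
  · exact mem_similarities_of_isSkewAdjoint (isSkewAdjoint_toEuclideanLin transpose_quatJ)
  · exact mem_similarities_of_isSkewAdjoint (isSkewAdjoint_toEuclideanLin transpose_quatK)

theorem isSkewAdjoint_opI : (innerₗ E4).IsSkewAdjoint opI :=
  isSkewAdjoint_toEuclideanLin transpose_quatI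

theorem opI_opI (x : E4) : opI (opI x) = -x := by
  have h : opI * opI = -1 := by
    rw [opI, ← toEuclideanLin_mul, quatI_mul_quatI, map_neg, toEuclideanLin_one]
  exact LinearMap.congr_fun h x

theorem opI_mul_mem_quaternions : ∀ a ∈ quaternions, opI * a ∈ quaternions := by
  have hmem : ∀ c ∈ ({1, quatI, quatJ, quatK} : Set (Matrix (Fin 4) (Fin 4) ℝ)),
      Matrix.toEuclideanLin c ∈ quaternions := fun c hc => Submodule.subset_span ⟨c, hc, rfl⟩
  have hle : quaternions ≤ quaternions.comap (LinearMap.mulLeft ℝ opI) := by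
    refine Submodule.span_le.2 ?_
    rintro _ ⟨b, hb, rfl⟩
    rw [SetLike.mem_coe, Submodule.mem_comap, LinearMap.mulLeft_apply, opI, ← toEuclideanLin_mul]
    rcases hb with rfl | rfl | rfl | rfl
    · exact mul_one quatI ▸ hmem _ (by simp)
    · rw [quatI_mul_quatI, map_neg]
      exact neg_mem (hmem _ (by simp))
    · exact quatI_mul_quatJ ▸ hmem _ (by simp)
    · rw [quatI_mul_quatK, map_neg]
      exact neg_mem (hmem _ (by simp))
  exact hle

theorem exists_mem_quaternions_apply_eq {e : E4} (he : e ≠ 0) (y : E4) :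
    ∃ a ∈ quaternions, a e = y := by
  have hframe : ‖e‖ ^ 2 • y = inner ℝ e y • e +
      inner ℝ (Matrix.toEuclideanLin quatI e) y • Matrix.toEuclideanLin quatI e +
      inner ℝ (Matrix.toEuclideanLin quatJ e) y • Matrix.toEuclideanLin quatJ e +
      inner ℝ (Matrix.toEuclideanLin quatK e) y • Matrix.toEuclideanLin quatK e := by
    rw [EuclideanSpace.real_norm_sq_eq, Fin.sum_univ_four]
    ext i
    fin_cases i <;>
    · simp [PiLp.inner_apply, Fin.sum_univ_four, Matrix.toLpLin_apply, dotProduct,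
        quatI, quatJ, quatK]
      ring
  have hmem : ∀ (c : ℝ), ∀ b ∈ ({1, quatI, quatJ, quatK} : Set (Matrix (Fin 4) (Fin 4) ℝ)),
      c • Matrix.toEuclideanLin b ∈ quaternions := fun c b hb =>
    Submodule.smul_mem _ c (Submodule.subset_span ⟨b, hb, rfl⟩)
  refine ⟨(‖e‖ ^ 2)⁻¹ • (inner ℝ e y • Matrix.toEuclideanLin 1 +
    inner ℝ (Matrix.toEuclideanLin quatI e) y • Matrix.toEuclideanLin quatI +
    inner ℝ (Matrix.toEuclideanLin quatJ e) y • Matrix.toEuclideanLin quatJ +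
    inner ℝ (Matrix.toEuclideanLin quatK e) y • Matrix.toEuclideanLin quatK),
    Submodule.smul_mem _ _ ?_, ?_⟩
  · refine add_mem (add_mem (add_mem ?_ ?_) ?_) ?_ <;> exact hmem _ _ (by simp)
  · rw [toEuclideanLin_one]
    simp only [LinearMap.smul_apply, LinearMap.add_apply, Module.End.one_apply]
    rw [← hframe, inv_smul_smul₀ (pow_ne_zero 2 (norm_ne_zero_iff.2 he))]

theorem skewAdjointSubmodule_eq_span_genRot :
    (innerₗ E4).skewAdjointSubmodule =
      Submodule.span ℝ {b | ∃ l r : Fin 4, l < r ∧ b = Matrix.toEuclideanLin (genRot l r)} := by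
  refine le_antisymm (fun a ha => ?_) (Submodule.span_le.2 ?_)
  · obtain ⟨A, rfl⟩ := Matrix.toEuclideanLin.surjective a
    have hskew : ∀ i j, A j i = -A i j := fun i j => by
      have := inner_apply_left_of_isSkewAdjoint ((LinearMap.mem_skewAdjointSubmodule _).1 ha)
        (EuclideanSpace.single i (1 : ℝ)) (EuclideanSpace.single j (1 : ℝ))
      simpa [Matrix.toLpLin_apply, Matrix.mulVec, dotProduct, PiLp.inner_apply, Pi.single_apply]
        using this
    have hdiag : ∀ i, A i i = 0 := fun i => by linarith [hskew i i]
    have hA : A = A 1 0 • genRot 0 1 + A 2 0 • genRot 0 2 + A 3 0 • genRot 0 3 +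
        A 2 1 • genRot 1 2 + A 3 1 • genRot 1 3 + A 3 2 • genRot 2 3 := by
      ext i j
      fin_cases i <;> fin_cases j <;> simp [genRot, hdiag, hskew 1 0, hskew 2 0, hskew 3 0,
        hskew 2 1, hskew 3 1, hskew 3 2]
    have hmem : ∀ (c : ℝ) (l r : Fin 4), l < r → c • Matrix.toEuclideanLin (genRot l r) ∈
        Submodule.span ℝ {b | ∃ l r : Fin 4, l < r ∧ b = Matrix.toEuclideanLin (genRot l r)} :=
      fun c l r hlr => Submodule.smul_mem _ c (Submodule.subset_span ⟨l, r, hlr, rfl⟩)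
    rw [hA]
    simp only [map_add, map_smul]
    refine add_mem (add_mem (add_mem (add_mem (add_mem ?_ ?_) ?_) ?_) ?_) ?_ <;>
      exact hmem _ _ _ (by decide)
  · rintro _ ⟨l, r, -, rfl⟩
    exact (LinearMap.mem_skewAdjointSubmodule _).2
      (isSkewAdjoint_toEuclideanLin (transpose_genRot l r))

end Quaternions

section Tangent

/-- The configurations `(c₁ v, …, cₙ v)`, `v ∈ ℝ⁴`; the translations are those with `c = 1`. -/
noncomputable def outer (c : Fin n → ℝ) : E4 →ₗ[ℝ] Config n where
  toFun v := WithLp.toLp 2 fun i => c i • v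
  map_add' v w := by ext1 i; exact smul_add (c i) v w
  map_smul' t v := by ext1 i; exact smul_comm (c i) t v

@[simp]
theorem outer_apply (c : Fin n → ℝ) (v : E4) (i : Fin n) : outer c v i = c i • v := rfl

/-- The linear map `a ↦ (a x₁, …, a xₙ)`. -/
noncomputable def orbitMap (x : Config n) : Module.End ℝ E4 →ₗ[ℝ] Config n where
  toFun a := diagAct a x
  map_add' _ _ := rfl
  map_smul' _ _ := rfl

@[simp]
theorem orbitMap_apply (x : Config n) (a : Module.End ℝ E4) : orbitMap x a = diagAct a x := rfl

/-- The configurations `(a q₁, …, a qₙ)`, `a ∈ A`. -/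
noncomputable def orbitSpan (A : Submodule ℝ (Module.End ℝ E4)) (q : Config n) :
    Submodule ℝ (Config n) :=
  A.map (orbitMap q)

/-- The configurations `(v + a q₁, …, v + a qₙ)`, `v ∈ ℝ⁴`, `a ∈ A`. The subspaces `E₁ ⊕ E₂ᵈ` and
`E₁ ⊕ E₂ˢ` of the phase space lie over such spaces. -/
noncomputable def affineOrbitSpan (A : Submodule ℝ (Module.End ℝ E4)) (q : Config n) :
    Submodule ℝ (Config n) :=
  LinearMap.range (outer 1) ⊔ orbitSpan A q

theorem E1_eq_phaseOver (m : Fin n → ℝ) : E1 m = phaseOver m (LinearMap.range (outer 1)) := by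
  have hconst : ∀ v : E4, (outer 1 v : Config n) = WithLp.toLp 2 fun _ => v := fun v => by
    ext1 i; simp
  apply le_antisymm
  · refine Submodule.span_le.2 ?_
    rintro _ ⟨v, w, rfl⟩
    exact ⟨⟨v, hconst v⟩, ⟨outer 1 w, ⟨w, rfl⟩, by rw [hconst]; rfl⟩⟩
  · rintro ⟨x, p⟩ ⟨⟨v, rfl : outer 1 v = x⟩, ⟨_, ⟨w, rfl⟩, rfl : massOp m _ = p⟩⟩
    exact Submodule.subset_span ⟨v, w, by rw [hconst, hconst]; rfl⟩

theorem E2d_eq_phaseOver (m : Fin n → ℝ) (q : Config n) :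
    E2d m q = phaseOver m (orbitSpan quaternions q) := by
  rw [orbitSpan, quaternions, Submodule.map_span, phaseOver_span, E2d]
  congr 1
  ext z
  simp only [diagAct_massOp, Set.image_image, Set.exists_mem_image, Set.mem_ofPred_eq,
    orbitMap_apply]

theorem E2s_eq_phaseOver (m : Fin n → ℝ) (q : Config n) :
    E2s m q = phaseOver m (orbitSpan similarities q) := by
  rw [orbitSpan, similarities, skewAdjointSubmodule_eq_span_genRot, ← Submodule.span_union,
    Submodule.map_span, phaseOver_span, E2s]
  congr 1
  ext z
  constructor
  · rintro ((rfl | rfl) | ⟨l, r, hlr, h⟩)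
    · exact ⟨q, ⟨1, Or.inl rfl, rfl⟩, Or.inl rfl⟩
    · exact ⟨q, ⟨1, Or.inl rfl, rfl⟩, Or.inr rfl⟩
    · exact ⟨_, ⟨_, Or.inr ⟨l, r, hlr, rfl⟩, rfl⟩, h⟩
  · rintro ⟨_, ⟨_, rfl | ⟨l, r, hlr, rfl⟩, rfl⟩, h⟩
    · exact Or.inl h
    · exact Or.inr ⟨l, r, hlr, h⟩

theorem E3d_eq_orthogonal_phaseOver (m : Fin n → ℝ) (q : Config n) :
    E3d m q = omega.orthogonal (phaseOver m (affineOrbitSpan quaternions q)) := by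
  rw [E3d, E1_eq_phaseOver, E2d_eq_phaseOver, ← phaseOver_sup, affineOrbitSpan]

theorem E3s_eq_orthogonal_phaseOver (m : Fin n → ℝ) (q : Config n) :
    E3s m q = omega.orthogonal (phaseOver m (affineOrbitSpan similarities q)) := by
  rw [E3s, E1_eq_phaseOver, E2s_eq_phaseOver, ← phaseOver_sup, affineOrbitSpan]

end Tangent

section AffineOrbit

variable {A : Submodule ℝ (Module.End ℝ E4)}

theorem diagAct_mem_orbitSpan_of_mul_mem {b : Module.End ℝ E4} (hb : ∀ a ∈ A, b * a ∈ A) :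
    ∀ x ∈ orbitSpan A q, diagAct b x ∈ orbitSpan A q := by
  rintro _ ⟨a, ha, rfl⟩
  exact ⟨b * a, hb a ha, rfl⟩

theorem diagAct_mem_affineOrbitSpan {b : E4 →ₗ[ℝ] E4}
    (hb : ∀ x ∈ orbitSpan A q, diagAct b x ∈ orbitSpan A q) :
    ∀ x ∈ affineOrbitSpan A q, diagAct b x ∈ affineOrbitSpan A q := by
  intro x hx
  obtain ⟨_, ⟨v, rfl⟩, y, hy, rfl⟩ := Submodule.mem_sup.1 hx
  have hconst : diagAct b (outer 1 v : Config n) = outer 1 (b v) := by ext1 i; simp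
  rw [map_add, hconst]
  exact Submodule.add_mem_sup ⟨b v, rfl⟩ (hb y hy)

theorem hessU_mem_map_massOp (hq : IsCentralConfiguration m q) (hone : 1 ∈ A)
    (hA : A ≤ similarities) :
    ∀ x ∈ affineOrbitSpan A q, hessU m q x ∈ (affineOrbitSpan A q).map (massOp m) := by
  have hgrad := eq_neg_of_add_eq_zero_left hq.balance
  intro x hx
  obtain ⟨_, ⟨v, rfl⟩, _, ⟨a, ha, rfl⟩, rfl⟩ := Submodule.mem_sup.1 hx
  have hconst : hessU m q (outer 1 v) = 0 := by
    convert hessU_const m hq.collisionFree v using 2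
    ext1 i
    simp
  obtain ⟨_, hc, b, hb, hab⟩ := Submodule.mem_sup.1 (hA ha)
  obtain ⟨c, rfl⟩ := Submodule.mem_span_singleton.1 hc
  have hsplit : diagAct a q = c • q + diagAct b q := congrArg (fun a => diagAct a q) hab.symm
  have hHess : hessU m q (diagAct a q) =
      massOp m (-(potential m q / inertia m q) • diagAct (a - (3 * c) • 1) q) := by
    rw [hsplit, map_add, map_smul, hessU_self m hq.collisionFree,
      hessU_diagAct_self m hq.collisionFree ((LinearMap.mem_skewAdjointSubmodule b).1 hb), hgrad,
      ← hab]
    ext1 i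
    simp
    module
  rw [map_add, hconst, zero_add, orbitMap_apply, hHess]
  exact Submodule.mem_map_of_mem (Submodule.smul_mem _ _ (Submodule.mem_sup_right
    ⟨_, A.sub_mem ha (A.smul_mem _ hone), rfl⟩))

theorem finrank_affineOrbitSpan (hcenter : ∑ i, m i • q i = 0) (hm : ∑ i, m i ≠ 0) :
    Module.finrank ℝ (affineOrbitSpan A q) = 4 + Module.finrank ℝ (orbitSpan A q) := by
  have hzero : ∀ x ∈ orbitSpan A q, ∑ i, m i • x i = 0 := by
    rintro _ ⟨a, -, rfl⟩
    simp only [orbitMap_apply, diagAct_apply, ← map_smul, ← map_sum, hcenter, map_zero]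
  have hconst : ∀ v : E4, ∑ i, m i • (outer 1 v : Config n) i = 0 → v = 0 := fun v hv => by
    simpa [← Finset.sum_smul, hm] using hv
  have hinj : Function.Injective (outer 1 : E4 →ₗ[ℝ] Config n) :=
    (injective_iff_map_eq_zero _).2 fun v hv => hconst v (by simp [hv])
  have hdisj : Disjoint (LinearMap.range (outer 1)) (orbitSpan A q) := by
    rw [Submodule.disjoint_def]
    rintro _ ⟨v, rfl⟩ hv
    rw [hconst v (hzero _ hv), map_zero]
  have hsum := Submodule.finrank_sup_add_finrank_inf_eq (LinearMap.range (outer 1)) (orbitSpan A q)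
  rwa [hdisj.eq_bot, finrank_bot, LinearMap.finrank_range_of_inj hinj, finrank_euclideanSpace,
    Fintype.card_fin, add_zero] at hsum

theorem map_projₗ_orbitSpan_eq_top (hA : quaternions ≤ A) {i : Fin n} (hi : q i ≠ 0) :
    (orbitSpan A q).map (PiLp.projₗ 2 (fun _ : Fin n => E4) i : Config n →ₗ[ℝ] E4) = ⊤ := by
  refine eq_top_iff.2 fun y _ => ?_
  obtain ⟨a, ha, hay⟩ := exists_mem_quaternions_apply_eq hi y
  exact ⟨_, ⟨a, hA ha, rfl⟩, hay⟩

theorem four_le_finrank_orbitSpan (hA : quaternions ≤ A) {i : Fin n} (hi : q i ≠ 0) :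
    4 ≤ Module.finrank ℝ (orbitSpan A q) := by
  have h := Submodule.finrank_map_le
    (PiLp.projₗ 2 (fun _ : Fin n => E4) i : Config n →ₗ[ℝ] E4) (orbitSpan A q)
  rwa [map_projₗ_orbitSpan_eq_top hA hi, finrank_top, finrank_euclideanSpace,
    Fintype.card_fin] at h

theorem orbitSpan_outer (hA : quaternions ≤ A) (c : Fin n → ℝ) {e : E4} (he : e ≠ 0) :
    orbitSpan A (outer c e) = LinearMap.range (outer c) := by
  have hdiag : ∀ a : Module.End ℝ E4, diagAct a (outer c e) = outer c (a e) := fun a => by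
    ext1 i; simp
  apply le_antisymm
  · rintro _ ⟨a, -, rfl⟩
    exact ⟨a e, (hdiag a).symm⟩
  · rintro _ ⟨v, rfl⟩
    obtain ⟨a, ha, rfl⟩ := exists_mem_quaternions_apply_eq he v
    exact ⟨a, hA ha, hdiag a⟩

end AffineOrbit

section AngularSpeed

theorem IsCentralConfiguration.exists_ne_zero (hq : IsCentralConfiguration m q) (hn : 2 ≤ n) :
    ∃ i, q i ≠ 0 := by
  by_contra! h
  exact hq.collisionFree ⟨0, by omega⟩ ⟨1, by omega⟩ (by simp) ((h _).trans (h _).symm)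

theorem potential_pos (hm : ∀ i, 0 < m i) (hq : ∀ i j, i ≠ j → q i ≠ q j) (hn : 2 ≤ n) :
    0 < potential m q := by
  have hterm : ∀ i, ∀ j ∈ Finset.Ioi i, 0 < m i * m j / ‖q i - q j‖ := fun i j hj =>
    div_pos (mul_pos (hm i) (hm j)) (norm_sub_pos_iff.2 (hq i j (Finset.mem_Ioi.1 hj).ne))
  refine Finset.sum_pos' (fun i _ => Finset.sum_nonneg fun j hj => (hterm i j hj).le)
    ⟨⟨0, by omega⟩, Finset.mem_univ _, Finset.sum_pos (hterm _) ⟨⟨1, by omega⟩, ?_⟩⟩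
  simp

theorem inertia_pos (hm : ∀ i, 0 < m i) {i : Fin n} (hi : q i ≠ 0) : 0 < inertia m q := by
  rw [inertia, inner_massOp_left]
  exact Finset.sum_pos' (fun j _ => mul_nonneg (hm j).le real_inner_self_nonneg)
    ⟨i, Finset.mem_univ i, mul_pos (hm i) (real_inner_self_pos.2 hi)⟩

theorem IsCentralConfiguration.angSpeed_ne_zero (hq : IsCentralConfiguration m q)
    (hm : ∀ i, 0 < m i) (hn : 2 ≤ n) : angSpeed m q ≠ 0 := by
  obtain ⟨i, hi⟩ := hq.exists_ne_zero hn
  exact (Real.sqrt_pos.2 (div_pos (potential_pos hm hq.collisionFree hn) (inertia_pos hm hi))).ne'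

end AngularSpeed
section MotionPlane

theorem relEquilibrium_apply (m : Fin n → ℝ) (q : Config n) (t : ℝ) (i : Fin n) :
    relEquilibrium m q t i =
      Matrix.toEuclideanLin (doubleRotation (angSpeed m q * t)) (q i) := rfl

theorem mem_motionSpan (m : Fin n → ℝ) (q : Config n) (i : Fin n) : q i ∈ motionSpan m q := by
  refine Submodule.subset_span ⟨0, i, ?_⟩
  have hone : doubleRotation 0 = 1 := by
    ext i j
    fin_cases i <;> fin_cases j <;> simp [doubleRotation]
  rw [relEquilibrium_apply, mul_zero, hone, toEuclideanLin_one, Module.End.one_apply]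

theorem quatI_mul_doubleRotation (φ : ℝ) :
    quatI * doubleRotation φ = doubleRotation (φ + Real.pi / 2) := by
  rw [doubleRotation, doubleRotation, Real.cos_add_pi_div_two, Real.sin_add_pi_div_two]
  ext i j
  fin_cases i <;> fin_cases j <;> simp [quatI, Matrix.mul_apply, Fin.sum_univ_four]

theorem opI_relEquilibrium (hk : angSpeed m q ≠ 0) (t : ℝ) (i : Fin n) :
    opI (relEquilibrium m q t i) = relEquilibrium m q (t + Real.pi / 2 / angSpeed m q) i := by
  rw [relEquilibrium_apply, relEquilibrium_apply, opI, ← Module.End.mul_apply,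
    ← toEuclideanLin_mul, quatI_mul_doubleRotation, mul_add, mul_div_cancel₀ _ hk]

theorem opI_mem_motionSpan (hk : angSpeed m q ≠ 0) :
    ∀ x ∈ motionSpan m q, opI x ∈ motionSpan m q := by
  have hle : motionSpan m q ≤ (motionSpan m q).comap opI := by
    refine Submodule.span_le.2 ?_
    rintro _ ⟨t, i, rfl⟩
    rw [SetLike.mem_coe, Submodule.mem_comap, opI_relEquilibrium hk]
    exact Submodule.subset_span ⟨_, i, rfl⟩
  exact fun x hx => hle hx

theorem IsPlanarRE.finrank_motionSpan_le (h : IsPlanarRE m q) :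
    Module.finrank ℝ (motionSpan m q) ≤ 2 := by
  obtain ⟨P, hP, hmem⟩ := h
  refine (Submodule.finrank_mono (Submodule.span_le.2 ?_)).trans_eq hP
  rintro _ ⟨t, i, rfl⟩
  exact hmem t i

theorem isSkewAdjoint_genDouble (m : Fin n → ℝ) (q : Config n) :
    (innerₗ E4).IsSkewAdjoint (genDouble m q) :=
  isSkewAdjoint_smul isSkewAdjoint_opI (angSpeed m q)

theorem isSkewAdjoint_genSimple (hk : angSpeed m q ≠ 0) :
    (innerₗ E4).IsSkewAdjoint (genSimple m q) :=
  isSkewAdjoint_smul (isSkewAdjoint_comp_starProjection isSkewAdjoint_opI (opI_mem_motionSpan hk))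
    (angSpeed m q)

theorem diagAct_genDouble_mem_orbitSpan (m : Fin n → ℝ) (q : Config n) :
    ∀ x ∈ orbitSpan quaternions q, diagAct (genDouble m q) x ∈ orbitSpan quaternions q :=
  diagAct_mem_orbitSpan_of_mul_mem fun a ha =>
    quaternions.smul_mem (angSpeed m q) (opI_mul_mem_quaternions a ha)

theorem diagAct_genSimple_mem_orbitSpan (hk : angSpeed m q ≠ 0) (hp : IsPlanarRE m q) :
    ∀ x ∈ orbitSpan similarities q, diagAct (genSimple m q) x ∈ orbitSpan similarities q := by
  have hP := opI_mem_motionSpan hk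
  rintro _ ⟨a, ha, rfl⟩
  obtain ⟨_, hc, b, hb, rfl⟩ := Submodule.mem_sup.1 ha
  obtain ⟨c, rfl⟩ := Submodule.mem_span_singleton.1 hc
  obtain ⟨d, hd⟩ := exists_forall_starProjection_apply_eq_smul isSkewAdjoint_opI opI_opI hP
    hp.finrank_motionSpan_le ((LinearMap.mem_skewAdjointSubmodule b).1 hb)
  have hskew := mem_similarities_of_isSkewAdjoint (isSkewAdjoint_genSimple hk)
  refine ⟨c • genSimple m q - (angSpeed m q * d) • 1, Submodule.sub_mem _
    (Submodule.smul_mem _ _ hskew) (Submodule.smul_mem _ _ one_mem_similarities), ?_⟩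
  ext1 i
  have hbi : genSimple m q (b (q i)) = -((angSpeed m q * d) • q i) := by
    change angSpeed m q • opI ((motionSpan m q).starProjection (b (q i))) = _
    rw [hd _ (mem_motionSpan m q i), map_smul, opI_opI]
    module
  simp [hbi, sub_eq_add_neg]

end MotionPlane

section Collinear

theorem isCollinear_of_forall_inner_eq_zero {J : E4 →ₗ[ℝ] E4} {P : Submodule ℝ E4}
    (hJ : (innerₗ E4).IsSkewAdjoint J) (hJJ : ∀ x, J (J x) = -x) (hP : ∀ x ∈ P, J x ∈ P)
    (hfin : Module.finrank ℝ P ≤ 2) (hqP : ∀ j, q j ∈ P) {e : E4} (he : e ∈ P) (he0 : e ≠ 0)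
    (hq : ∀ j, inner ℝ (J e) (q j) = 0) : IsCollinear q := by
  refine (collinear_iff_exists_forall_eq_smul_vadd _).2 ⟨0, e, ?_⟩
  rintro _ ⟨j, rfl⟩
  have hj := hqP j
  rw [← span_pair_apply_eq_of_finrank_le_two hJ hJJ hP hfin he he0] at hj
  obtain ⟨α, β, hαβ⟩ := Submodule.mem_span_pair.1 hj
  have hJe : inner ℝ (J e) (J e) ≠ (0 : ℝ) := by
    rwa [inner_apply_left_of_isSkewAdjoint hJ, hJJ, inner_neg_right, neg_neg, inner_self_ne_zero]
  have hβ := hq j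
  rw [← hαβ, inner_add_right, real_inner_smul_right, real_inner_smul_right, real_inner_comm,
    inner_self_apply_of_isSkewAdjoint hJ, mul_zero, zero_add] at hβ
  refine ⟨α, hαβ.symm.trans ?_⟩
  rw [(mul_eq_zero.1 hβ).resolve_right hJe, zero_smul, add_zero, vadd_eq_add, add_zero]

theorem outer_inner_mem_orbitSpan_similarities (u : E4) {v : E4} (hv : ∀ l, inner ℝ v (q l) = 0) :
    outer (fun l => inner ℝ u (q l)) v ∈ orbitSpan similarities q := by
  -- The infinitesimal rotation `u ∧ v` maps `q l` to `⟪u, q l⟫ v`, as `v ⟂ q l`.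
  set a : E4 →ₗ[ℝ] E4 := (innerₗ E4 u).smulRight v - (innerₗ E4 v).smulRight u with ha
  have hskew : (innerₗ E4).IsSkewAdjoint a := fun x y => by
    simp only [ha, Pi.neg_apply, LinearMap.sub_apply, LinearMap.smulRight_apply,
      innerₗ_apply_apply, inner_sub_left, inner_neg_right, inner_sub_right, real_inner_smul_left,
      real_inner_smul_right, real_inner_comm v x, real_inner_comm u x]
    ring
  refine ⟨a, mem_similarities_of_isSkewAdjoint hskew, ?_⟩
  ext1 l
  simp [ha, hv l]

theorem IsPlanarRE.six_le_finrank_orbitSpan (hp : IsPlanarRE m q) (hc : ¬ IsCollinear q)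
    (hk : angSpeed m q ≠ 0) {i : Fin n} (hi : q i ≠ 0) :
    6 ≤ Module.finrank ℝ (orbitSpan similarities q) := by
  set P := motionSpan m q
  have hqP : ∀ j, q j ∈ P := mem_motionSpan m q
  let c : Fin n → ℝ := fun l => inner ℝ (opI (q i)) (q l)
  have hci : c i = 0 :=
    (real_inner_comm _ _).trans (inner_self_apply_of_isSkewAdjoint isSkewAdjoint_opI (q i))
  obtain ⟨j, hj⟩ : ∃ j, c j ≠ 0 := by
    by_contra! h
    exact hc (isCollinear_of_forall_inner_eq_zero isSkewAdjoint_opI opI_opI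
      (opI_mem_motionSpan hk) hp.finrank_motionSpan_le hqP (hqP i) hi h)
  have hinj : Function.Injective (outer c) := fun v w h =>
    smul_right_injective E4 hj (congrArg (fun x : Config n => x j) h)
  have hle : Pᗮ.map (outer c) ≤ orbitSpan similarities q := by
    rintro _ ⟨v, hv, rfl⟩
    exact outer_inner_mem_orbitSpan_similarities _ fun l =>
      (real_inner_comm _ _).trans (hv _ (hqP l))
  have hker : Pᗮ.map (outer c) ≤
      LinearMap.ker (PiLp.projₗ 2 (fun _ : Fin n => E4) i : Config n →ₗ[ℝ] E4) := by
    rintro _ ⟨v, -, rfl⟩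
    simp [hci]
  have hsum := finrank_add_finrank_map_le_finrank hle hker
  rw [map_projₗ_orbitSpan_eq_top quaternions_le_similarities hi, finrank_top,
    ← (Submodule.equivMapOfInjective (outer c) hinj Pᗮ).finrank_eq] at hsum
  have hdim := P.finrank_add_finrank_orthogonal
  have hP : Module.finrank ℝ P ≤ 2 := hp.finrank_motionSpan_le
  rw [finrank_euclideanSpace, Fintype.card_fin] at hsum hdim
  omega

theorem IsCollinear.exists_eq_outer (hc : IsCollinear q) (hcenter : ∑ i, m i • q i = 0)
    (hm : ∑ i, m i ≠ 0) : ∃ c e, q = outer c e := by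
  obtain ⟨p, e, h⟩ := (collinear_iff_exists_forall_eq_smul_vadd _).1 hc
  choose r hr using fun l => h (q l) ⟨l, rfl⟩
  have hp : p = (-((∑ i, m i)⁻¹ * ∑ i, m i * r i)) • e := by
    simp_rw [hr, vadd_eq_add, smul_add, smul_smul, Finset.sum_add_distrib, ← Finset.sum_smul]
      at hcenter
    rw [neg_smul, mul_smul, eq_neg_of_add_eq_zero_left hcenter, smul_neg, neg_neg,
      inv_smul_smul₀ hm]
  refine ⟨fun l => r l + -((∑ i, m i)⁻¹ * ∑ i, m i * r i), e, ?_⟩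
  ext1 l
  rw [outer_apply, add_smul, ← hp]
  exact hr l

theorem IsCollinear.orbitSpan_similarities_eq (hc : IsCollinear q)
    (hcenter : ∑ i, m i • q i = 0) (hm : ∑ i, m i ≠ 0) {i : Fin n} (hi : q i ≠ 0) :
    orbitSpan similarities q = orbitSpan quaternions q := by
  obtain ⟨c, e, rfl⟩ := hc.exists_eq_outer hcenter hm
  have he : e ≠ 0 := by
    rintro rfl
    simp at hi
  rw [orbitSpan_outer quaternions_le_similarities c he, orbitSpan_outer le_rfl c he]

theorem IsCollinear.diagAct_mem_orbitSpan_quaternions (hc : IsCollinear q)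
    (hcenter : ∑ i, m i • q i = 0) (hm : ∑ i, m i ≠ 0) {i : Fin n} (hi : q i ≠ 0)
    (b : E4 →ₗ[ℝ] E4) :
    ∀ x ∈ orbitSpan quaternions q, diagAct b x ∈ orbitSpan quaternions q := by
  obtain ⟨c, e, rfl⟩ := hc.exists_eq_outer hcenter hm
  have he : e ≠ 0 := by
    rintro rfl
    simp at hi
  rw [orbitSpan_outer le_rfl c he]
  rintro _ ⟨v, rfl⟩
  refine ⟨b v, ?_⟩
  ext1 l
  simp

end Collinear

section CommutingFrame

theorem hamL_add (m : Fin n → ℝ) (q : Config n) (a b : E4 →ₗ[ℝ] E4) :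
    hamL m q (a + b) = hamL m q a + (diagAct b).prodMap (diagAct b) := by
  ext1 <;> refine LinearMap.ext fun x => Prod.ext ?_ ?_ <;> ext1 i <;> simp [hamL_apply]

theorem commute_hamL_prodMap_diagAct {b : Module.End ℝ E4} (hab : Commute a b)
    (hb : ∀ x, hessU m q (diagAct b x) = diagAct b (hessU m q x)) :
    Commute (hamL m q a) ((diagAct b).prodMap (diagAct b)) := by
  have hdiag : ∀ x : Config n, diagAct a (diagAct b x) = diagAct b (diagAct a x) := fun x => by
    ext1 i
    exact LinearMap.congr_fun hab (x i)
  refine LinearMap.ext fun z => ?_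
  simp only [Module.End.mul_apply, LinearMap.prodMap_apply, hamL_apply, hdiag, hb, map_add,
    massInv_eq_massOp_inv, diagAct_massOp]

theorem isSkewAdjoint_prodMap_diagAct {b : E4 →ₗ[ℝ] E4} (hb : (innerₗ E4).IsSkewAdjoint b) :
    (omega (n := n)).IsSkewAdjoint ((diagAct b).prodMap (diagAct b)) := fun z w => by
  have hdiag := inner_apply_left_of_isSkewAdjoint (isSkewAdjoint_diagAct (n := n) hb)
  simp only [omega_apply, LinearMap.prodMap_apply, Pi.neg_apply, Prod.fst_neg, Prod.snd_neg,
    inner_neg_right, hdiag]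

theorem prodMap_diagAct_mem_phaseOver {T : Submodule ℝ (Config n)} {b : E4 →ₗ[ℝ] E4}
    (hb : ∀ x ∈ T, diagAct b x ∈ T) :
    ∀ z ∈ phaseOver m T, (diagAct b).prodMap (diagAct b) z ∈ phaseOver m T := by
  rintro ⟨x, p⟩ ⟨hx, ⟨y, hy, rfl : massOp m y = p⟩⟩
  exact ⟨hb x hx, diagAct b y, hb y hy, (diagAct_massOp m b y).symm⟩

theorem hessU_diagAct_comp_starProjection {J : E4 →ₗ[ℝ] E4} {P : Submodule ℝ E4}
    (hJ : (innerₗ E4).IsSkewAdjoint J) (hJJ : ∀ x, J (J x) = -x) (hP : ∀ x ∈ P, J x ∈ P)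
    (hqP : ∀ i, q i ∈ P) (x : Config n) :
    hessU m q (diagAct (J ∘ₗ Pᗮ.starProjection.toLinearMap) x) =
      diagAct (J ∘ₗ Pᗮ.starProjection.toLinearMap) (hessU m q x) := by
  have hfix : ∀ i, P.starProjection (q i) = q i ∧ Pᗮ.starProjection (q i) = 0 := fun i =>
    ⟨Submodule.starProjection_eq_self_iff.2 (hqP i),
      Submodule.starProjection_orthogonal_apply_eq_zero (hqP i)⟩
  -- `J ∘ π_{Pᗮ}` is half the difference of the isometries `1 ⊕ J` and `1 ⊕ -J`, which fix `q`.
  let R := quarterTurn hJ hJJ hP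
  let R' := quarterTurn (isSkewAdjoint_smul hJ (-1)) (by simpa using hJJ) (by simpa using hP)
  have hR : ∀ i, R (q i) = q i := fun i => by
    simp [R, quarterTurn_apply, hfix i]
  have hR' : ∀ i, R' (q i) = q i := fun i => by
    simp [R', quarterTurn_apply, hfix i]
  have hsplit : ∀ y : Config n, diagAct (J ∘ₗ Pᗮ.starProjection.toLinearMap) y =
      (2 : ℝ)⁻¹ • (diagAct R.toLinearMap y - diagAct R'.toLinearMap y) := fun y => by
    ext1 i
    simp [R, R', quarterTurn_apply]
    module
  rw [hsplit, hsplit, map_smul, map_sub, hessU_diagAct_linearIsometryEquiv m hR,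
    hessU_diagAct_linearIsometryEquiv m hR']

end CommutingFrame

section CommutingStability

variable {L C : Module.End ℝ (Phase n)} {E : Submodule ℝ (Phase n)}

theorem IsStableOn.add_of_commute (hL : IsStableOn L E) (hC : IsStableOn C E) (h : Commute L C)
    (hCE : ∀ z ∈ E, C z ∈ E) : IsStableOn (L + C) E := by
  rintro μ ⟨v, hv, hv0, hμ⟩
  let LC : Module.End ℂ (ℂ ⊗[ℝ] Phase n) := L.baseChange ℂ
  let CC : Module.End ℂ (ℂ ⊗[ℝ] Phase n) := C.baseChange ℂ
  -- The commuting operators `L` and `C` have a common eigenvector in this subspace.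
  let W := (LC + CC).eigenspace μ ⊓ E.baseChange ℂ
  have hcomm : Commute LC CC := by
    change L.baseChange ℂ * C.baseChange ℂ = C.baseChange ℂ * L.baseChange ℂ
    rw [← LinearMap.baseChange_mul, h.eq, LinearMap.baseChange_mul]
  have hCCE : E.baseChange ℂ ≤ (E.baseChange ℂ).comap CC := by
    rw [Submodule.baseChange_eq_span, Submodule.span_le]
    rintro _ ⟨z, hz, rfl⟩
    exact Submodule.subset_span ⟨C z, hCE z hz, (LinearMap.baseChange_tmul _ _ _).symm⟩
  have hW : ∀ w ∈ W, CC w ∈ W := fun w hw =>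
    ⟨Module.End.mapsTo_genEigenspace_of_comm (hcomm.add_left (Commute.refl CC)) μ 1 hw.1,
      hCCE hw.2⟩
  have hvW : v ∈ W := ⟨Module.End.mem_eigenspace_iff.2 (by rwa [← LinearMap.baseChange_add]), hv⟩
  have : Nontrivial W := ⟨⟨v, hvW⟩, 0, fun h0 => hv0 (congrArg Subtype.val h0)⟩
  obtain ⟨ν, hν⟩ := Module.End.exists_eigenvalue (CC.restrict hW)
  obtain ⟨⟨w, hw⟩, hwν, hw0⟩ := hν.exists_hasEigenvector
  have hw0' : w ≠ 0 := fun h0 => hw0 (Subtype.ext h0)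
  have hCw : CC w = ν • w := congrArg Subtype.val (Module.End.mem_eigenspace_iff.1 hwν)
  have hLw : LC w = (μ - ν) • w := by
    rw [sub_smul, ← hCw, ← Module.End.mem_eigenspace_iff.1 hw.1, LinearMap.add_apply,
      add_sub_cancel_right]
  rw [← sub_add_cancel μ ν, Complex.add_re, hL _ ⟨w, hw.2, hw0', hLw⟩, hC _ ⟨w, hw.2, hw0', hCw⟩,
    add_zero]

theorem isStableOn_of_pow_three_eq (c : ℝ) (hC : C ^ 3 = -(c ^ 2) • C) : IsStableOn C E := by
  rintro μ ⟨v, -, hv0, hμ⟩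
  have hcube : C.baseChange ℂ ^ 3 = -(c ^ 2) • C.baseChange ℂ := by
    rw [← LinearMap.baseChange_pow, hC, LinearMap.baseChange_smul]
  have hpow := Module.End.HasEigenvector.pow_apply ⟨Module.End.mem_eigenspace_iff.2 hμ, hv0⟩ 3
  rw [hcube, LinearMap.smul_apply, hμ, ← smul_assoc, Complex.real_smul, ← sub_eq_zero, ← sub_smul]
    at hpow
  have hroot : μ * (μ ^ 2 + c ^ 2) = 0 := by
    have hcoeff := (smul_eq_zero.1 hpow).resolve_right hv0
    push_cast at hcoeff
    linear_combination -hcoeff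
  rcases mul_eq_zero.1 hroot with rfl | hμc
  · rfl
  have hre := congrArg Complex.re hμc
  have him := congrArg Complex.im hμc
  simp only [sq, Complex.add_re, Complex.add_im, Complex.mul_re, Complex.mul_im,
    Complex.ofReal_re, Complex.ofReal_im, Complex.zero_re, Complex.zero_im] at hre him
  by_contra hne
  have him0 : μ.im = 0 := by
    refine (mul_eq_zero.1 ?_).resolve_left hne
    linarith
  rw [him0] at hre
  nlinarith [sq_pos_of_ne_zero hne, sq_nonneg c]

end CommutingStability

section PerpendicularRotation

/-- The generator of the rotation of the orthogonal complement of the plane of motion by which the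
double rotation differs from the simple one. -/
noncomputable def genPerp (m : Fin n → ℝ) (q : Config n) : E4 →ₗ[ℝ] E4 :=
  genDouble m q ∘ₗ (motionSpan m q)ᗮ.starProjection.toLinearMap

theorem genSimple_add_genPerp (m : Fin n → ℝ) (q : Config n) :
    genSimple m q + genPerp m q = genDouble m q := by
  refine LinearMap.ext fun x => ?_
  rw [LinearMap.add_apply, genSimple, genPerp, LinearMap.comp_apply, LinearMap.comp_apply,
    ← map_add]
  exact congrArg _ ((motionSpan m q).starProjection_add_starProjection_orthogonal x)

theorem isSkewAdjoint_genPerp (hk : angSpeed m q ≠ 0) :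
    (innerₗ E4).IsSkewAdjoint (genPerp m q) :=
  isSkewAdjoint_smul (isSkewAdjoint_comp_starProjection isSkewAdjoint_opI
    (apply_mem_orthogonal_of_forall_mem isSkewAdjoint_opI (opI_mem_motionSpan hk))) (angSpeed m q)

theorem hessU_diagAct_genPerp (hk : angSpeed m q ≠ 0) (x : Config n) :
    hessU m q (diagAct (genPerp m q) x) = diagAct (genPerp m q) (hessU m q x) := by
  have hsmul : ∀ y : Config n, diagAct (genPerp m q) y = angSpeed m q •
      diagAct (opI ∘ₗ (motionSpan m q)ᗮ.starProjection.toLinearMap) y := fun y => rfl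
  rw [hsmul, hsmul, map_smul, hessU_diagAct_comp_starProjection isSkewAdjoint_opI opI_opI
    (opI_mem_motionSpan hk) (mem_motionSpan m q)]

theorem commute_genSimple_genPerp (hk : angSpeed m q ≠ 0) :
    Commute (genSimple m q : Module.End ℝ E4) (genPerp m q) := by
  have hcomm : Commute (genSimple m q : Module.End ℝ E4) (genDouble m q) := by
    refine LinearMap.ext fun x => congrArg (genDouble m q) ?_
    change (motionSpan m q).starProjection (angSpeed m q • opI x) = _
    rw [map_smul, starProjection_apply_of_isSkewAdjoint isSkewAdjoint_opI (opI_mem_motionSpan hk)]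
    rfl
  rw [← add_sub_cancel_left (genSimple m q) (genPerp m q), genSimple_add_genPerp]
  exact hcomm.sub_right (Commute.refl _)

theorem genPerp_pow_three (hk : angSpeed m q ≠ 0) :
    (genPerp m q : Module.End ℝ E4) ^ 3 = -(angSpeed m q ^ 2) • genPerp m q := by
  have hP := apply_mem_orthogonal_of_forall_mem isSkewAdjoint_opI (opI_mem_motionSpan hk)
  have happly : ∀ x, genPerp m q x =
      angSpeed m q • opI ((motionSpan m q)ᗮ.starProjection x) := fun _ => rfl
  have hmem : ∀ x, genPerp m q x ∈ (motionSpan m q)ᗮ := fun x =>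
    Submodule.smul_mem _ _ (hP _ (Submodule.starProjection_apply_mem _ x))
  have hgen : ∀ x, genPerp m q (genPerp m q x) = angSpeed m q • opI (genPerp m q x) := fun x => by
    rw [happly (genPerp m q x), Submodule.starProjection_eq_self_iff.2 (hmem x)]
  refine LinearMap.ext fun x => ?_
  change genPerp m q (genPerp m q (genPerp m q x)) = -(angSpeed m q ^ 2) • genPerp m q x
  rw [hgen, hgen, map_smul, opI_opI]
  module

theorem IsStableOn.hamL_genDouble {T : Submodule ℝ (Config n)}
    (hs : IsStableOn (hamL m q (genSimple m q)) (omega.orthogonal (phaseOver m T)))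
    (hk : angSpeed m q ≠ 0) (hT : ∀ x ∈ T, diagAct (genPerp m q) x ∈ T) :
    IsStableOn (hamL m q (genDouble m q)) (omega.orthogonal (phaseOver m T)) := by
  have hcube : ((diagAct (genPerp m q)).prodMap (diagAct (genPerp m q)) :
      Module.End ℝ (Phase n)) ^ 3 =
      -(angSpeed m q ^ 2) • (diagAct (genPerp m q)).prodMap (diagAct (genPerp m q)) := by
    refine LinearMap.ext fun z => Prod.ext ?_ ?_ <;> ext1 i <;>
      exact LinearMap.congr_fun (genPerp_pow_three hk) _
  rw [← genSimple_add_genPerp, hamL_add]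
  exact hs.add_of_commute (isStableOn_of_pow_three_eq _ hcube)
    (commute_hamL_prodMap_diagAct (commute_genSimple_genPerp hk) (hessU_diagAct_genPerp hk))
    (apply_mem_orthogonal_of_isSkewAdjoint
      (isSkewAdjoint_prodMap_diagAct (isSkewAdjoint_genPerp hk))
      (prodMap_diagAct_mem_phaseOver hT))

end PerpendicularRotation

section SpectralStability

theorem sum_mass_ne_zero (hm : ∀ i, 0 < m i) (hn : 0 < n) : ∑ i, m i ≠ 0 :=
  (Finset.sum_pos (fun i _ => hm i) ⟨⟨0, hn⟩, Finset.mem_univ _⟩).ne'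

theorem IsSpectrallyStable.isStableOn_genSimple (h : IsSpectrallyStable m q)
    (hp : IsPlanarRE m q) : IsStableOn (hamL m q (genSimple m q)) (E3s m q) := by
  rwa [IsSpectrallyStable, if_pos hp] at h

theorem IsSpectrallyStable.isStableOn_genDouble (h : IsSpectrallyStable m q)
    (hcase : ¬ IsPlanarRE m q ∨ IsCollinear q) (hq : IsCentralConfiguration m q)
    (hm : ∀ i, 0 < m i) (hn : 2 ≤ n) : IsStableOn (hamL m q (genDouble m q)) (E3d m q) := by
  by_cases hp : IsPlanarRE m q
  · have hc := hcase.resolve_left (not_not.2 hp)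
    obtain ⟨i, hi⟩ := hq.exists_ne_zero hn
    have hmass := sum_mass_ne_zero hm (by omega)
    have hs := h.isStableOn_genSimple hp
    rw [E3s_eq_orthogonal_phaseOver, affineOrbitSpan,
      hc.orbitSpan_similarities_eq hq.center hmass hi] at hs
    rw [E3d_eq_orthogonal_phaseOver]
    exact hs.hamL_genDouble (hq.angSpeed_ne_zero hm hn) (diagAct_mem_affineOrbitSpan
      (hc.diagAct_mem_orbitSpan_quaternions hq.center hmass hi (genPerp m q)))
  · rwa [IsSpectrallyStable, if_neg hp] at h

theorem IsStableOn.even_indexB3Ker_genDouble_sub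
    (hs : IsStableOn (hamL m q (genDouble m q)) (E3d m q)) (hq : IsCentralConfiguration m q)
    (hm : ∀ i, 0 < m i) (hn : 2 ≤ n) :
    Even ((indexB3Ker m q (genDouble m q) (E3d m q) (8 * n - 16) : ℤ) -
      indexB3 m q (genDouble m q) (E3d m q)) := by
  obtain ⟨i, hi⟩ := hq.exists_ne_zero hn
  have hmass := sum_mass_ne_zero hm (by omega)
  rw [E3d_eq_orthogonal_phaseOver] at hs ⊢
  refine hs.even_indexB3Ker_sub_indexB3 hm (hessU_isSymmetric m hq.collisionFree)
    (isSkewAdjoint_genDouble m q)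
    (diagAct_mem_affineOrbitSpan (diagAct_genDouble_mem_orbitSpan m q))
    (hessU_mem_map_massOp hq one_mem_quaternions quaternions_le_similarities) ?_
  have hfour := four_le_finrank_orbitSpan (q := q) le_rfl hi
  rw [finrank_affineOrbitSpan hq.center hmass]
  omega

theorem IsStableOn.even_indexB3Ker_genSimple_sub
    (hs : IsStableOn (hamL m q (genSimple m q)) (E3s m q)) (hp : IsPlanarRE m q)
    (hq : IsCentralConfiguration m q) (hm : ∀ i, 0 < m i) (hn : 2 ≤ n) {N : ℕ}
    (hN : 8 * n ≤ N + 2 * (4 + Module.finrank ℝ (orbitSpan similarities q))) :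
    Even ((indexB3Ker m q (genSimple m q) (E3s m q) N : ℤ) -
      indexB3 m q (genSimple m q) (E3s m q)) := by
  have hk := hq.angSpeed_ne_zero hm hn
  have hmass := sum_mass_ne_zero hm (by omega)
  rw [E3s_eq_orthogonal_phaseOver] at hs ⊢
  refine hs.even_indexB3Ker_sub_indexB3 hm (hessU_isSymmetric m hq.collisionFree)
    (isSkewAdjoint_genSimple hk)
    (diagAct_mem_affineOrbitSpan (diagAct_genSimple_mem_orbitSpan hk hp))
    (hessU_mem_map_massOp hq one_mem_similarities le_rfl) ?_
  rwa [finrank_affineOrbitSpan hq.center hmass]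

end SpectralStability

end RelEq

theorem mainTheorem1 (n : ℕ) (hn : 3 ≤ n) (m : Fin n → ℝ) (hm : ∀ i, 0 < m i)
    (q : RelEq.Config n) (hq : RelEq.IsCentralConfiguration m q) :
    (((¬ RelEq.IsPlanarRE m q ∨ (RelEq.IsPlanarRE m q ∧ RelEq.IsCollinear q)) ∧
        Odd ((RelEq.indexB3Ker m q (RelEq.genDouble m q) (RelEq.E3d m q) (8 * n - 16) : ℤ) -
          (RelEq.indexB3 m q (RelEq.genDouble m q) (RelEq.E3d m q) : ℤ))) →
      ¬ RelEq.IsSpectrallyStable m q) ∧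
    ((RelEq.IsPlanarRE m q ∧ RelEq.IsCollinear q ∧
        Odd ((RelEq.indexB3Ker m q (RelEq.genSimple m q) (RelEq.E3s m q) (8 * n - 16) : ℤ) -
          (RelEq.indexB3 m q (RelEq.genSimple m q) (RelEq.E3s m q) : ℤ))) →
      ¬ RelEq.IsSpectrallyStable m q) ∧
    ((RelEq.IsPlanarRE m q ∧ ¬ RelEq.IsCollinear q ∧
        Odd ((RelEq.indexB3Ker m q (RelEq.genSimple m q) (RelEq.E3s m q) (8 * n - 20) : ℤ) -
          (RelEq.indexB3 m q (RelEq.genSimple m q) (RelEq.E3s m q) : ℤ))) →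
      ¬ RelEq.IsSpectrallyStable m q) := by
  obtain ⟨i, hi⟩ := hq.exists_ne_zero (by omega)
  refine ⟨?_, ?_, ?_⟩
  · rintro ⟨hcase, hodd⟩ hstable
    have hs := hstable.isStableOn_genDouble (hcase.imp_right And.right) hq hm (by omega)
    exact Int.not_even_iff_odd.2 hodd (hs.even_indexB3Ker_genDouble_sub hq hm (by omega))
  · rintro ⟨hp, -, hodd⟩ hstable
    have hrank := RelEq.four_le_finrank_orbitSpan RelEq.quaternions_le_similarities hi
    have hs := hstable.isStableOn_genSimple hp
    exact Int.not_even_iff_odd.2 hodd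
      (hs.even_indexB3Ker_genSimple_sub hp hq hm (by omega) (by omega))
  · rintro ⟨hp, hc, hodd⟩ hstable
    have hrank := hp.six_le_finrank_orbitSpan hc (hq.angSpeed_ne_zero hm (by omega)) hi
    have hs := hstable.isStableOn_genSimple hp
    exact Int.not_even_iff_odd.2 hodd
      (hs.even_indexB3Ker_genSimple_sub hp hq hm (by omega) (by omega))
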